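/- **Setting.** A multipartite non-signaling device with finite input alphabets and finite output alphabets is a conditional distribution $P(\mathbf a|\mathbf x)$ such that, for every subset of the parties, the marginal distribution of their outputs depends only on their own inputs. These devices form a polytope; its extreme points are the pure devices. A pure-members ensemble of $P$ is a set of distinct pure devices with positive probabilities whose average is $P$; it is minimal if no proper subset of its members, with any probabilities, is an ensemble of $P$. The complete extension of $P$ is the device $\mathcal E(P)$ with one more party, Eve, whose inputs $z$ are in one-to-one correspondence with the minimal ensembles $\{p(e|z),P^{e,z}\}$ of $P$ and $\mathcal E(P)(\mathbf a,e|\mathbf x,z)=p(e|z)\,P^{e,z}(\mathbf a|\mathbf x)$, where the output $e$ labels the member of the ensemble (the label is the pure device itself). **Information quantities** (logarithms to base 2). For a finite distribution $P(ABE)$: $I(A:B)=H(A)+H(B)-H(AB)$; $I(A:B|E)=H(A|E)+H(B|E)-H(AB|E)$; $I(A:B\downarrow E)=\inf_{\Theta_{E'|E}}I(A:B|E')$ over all channels from $E$ to finite alphabets; $I(A:B\downarrow\downarrow E)=\inf_{\Theta_{U|ABE}}\big(I(A:B\downarrow EU)+H(U)\big)$ over all channels from $ABE$ to finite alphabets.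 For a function $M$ of such distributions and a device $R(ABE|XYZ)$ put $$\widehat M(A:B\|E)_{R}=\max_{x,y}\ \inf_{p}\ M\Big(\textstyle\sum_z p(z)\,R(ABE|X=x,Y=y,Z=z)\Big),$$ where $p$ ranges over the probability distributions on Eve's inputs. The squashed non-locality of a bipartite device $P(AB|XY)$ is $\mathcal N_{sq}(P)=\widehat I(A:B\downarrow E)_{\mathcal E(P)}$. **Key rate.** Let $P=P(AB|XY)$ be a bipartite non-signaling device. $P^{\otimes N}$ is regarded as a non-signaling device of $2N$ parties, and Eve holds the extending part of $\mathcal E(P^{\otimes N})$. An MDLOPC operation $\Lambda_N$ consists of a direct measurement of a fixed input pair $(x,y)$ on all $N$ copies, followed by a protocol with finitely many rounds of local (randomized) operations and public communication on the outputs, which yields keys $S_A,S_B$ in a set of $d_N$ elements and the public communication $Q$. Let $P_{\mathrm{out}}(s_A,s_B,q,e|z)$ be the resulting state and $$P_{\mathrm{ideal}}(s_A,s_B,q,e|z)=\frac{\delta_{s_A,s_B}}{d_N}\sum_{s_A',s_B'}P_{\mathrm{out}}(s_A',s_B',q,e|z).$$ The non-signaling norm $\|P_{\mathrm{out}}-P_{\mathrm{ideal}}\|_{NS}$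 is the supremum of $\frac12\|g(P_{\mathrm{out}})-g(P_{\mathrm{ideal}})\|_1$ over all operations $g$ of a distinguisher who reads $(s_A,s_B,q)$, chooses the input $z$ by means of auxiliary randomness and these data, and stochastically post-processes everything to a finite outcome. A sequence $\Lambda=(\Lambda_N)_N$ is a key distillation protocol for $P$ if this norm tends to $0$ as $N\to\infty$, and $$K_{DI}^{(iid)}(P)=\sup_{\Lambda}\ \limsup_{N\to\infty}\frac{\log_2 d_N}{N},$$ with the supremum over all key distillation protocols for $P$. **Corollary.** For every bipartite non-signaling device $P$ with finite output alphabets and finite non-empty input alphabets, $$\widehat I(A:B)_{\mathcal E(P)}\ge K_{DI}^{(iid)}(P),\qquad \widehat I(A:B|E)_{\mathcal E(P)}\ge K_{DI}^{(iid)}(P),$$ $$\min\big\{\widehat I(A:B)_{\mathcal E(P)},\ \widehat I(A:B|E)_{\mathcal E(P)}\big\}\ge K_{DI}^{(iid)}(P),$$ $$\mathcal N_{sq}(P)=\widehat I(A:B\downarrow E)_{\mathcal E(P)}\ \ge\ \widehat I(A:B\downarrow\downarrow E)_{\mathcal E(P)}\ \ge\ K_{DI}^{(iid)}(P).$$ 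-/

import Mathlib

namespace NSDI

/-! ### Multipartite non-signaling devices

Parties are indexed by `ι`; party `i` has input alphabet `X i` and output alphabet `A i`. -/

section Devices

variable {ι : Type*} (X A : ι → Type*)

/-- Real-valued tables `P x a`, read as `P(a | x)` for joint inputs `x` and joint outputs `a`. -/
abbrev Box := (∀ i, X i) → (∀ i, A i) → ℝ

open Classical in
/-- The polytope of fully non-signaling devices: nonnegative, normalized, and the outputs of every
set `S` of parties have a marginal distribution which depends on the inputs of `S` only. -/
def nsPolytope [Fintype ι] [DecidableEq ι] [∀ i, Fintype (A i)] : Set (Box X A) :=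
  {P | (∀ x a, 0 ≤ P x a) ∧ (∀ x, ∑ a, P x a = 1) ∧
    ∀ (S : Set ι) (x x' : ∀ i, X i), (∀ i ∈ S, x i = x' i) → ∀ a : ∀ i, A i,
      (∑ a', if ∀ i ∈ S, a' i = a i then P x a' else 0) =
        ∑ a', if ∀ i ∈ S, a' i = a i then P x' a' else 0}

variable [Fintype ι] [DecidableEq ι] [∀ i, Fintype (A i)]

/-- Pure (extremal) devices. -/
abbrev PureDevice : Type _ := ((nsPolytope X A).extremePoints ℝ : Set (Box X A))

variable {X A}

theorem eq_of_extreme_of_zeros [∀ i, Fintype (X i)] {V W : Box X A}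
    (hV : V ∈ (nsPolytope X A).extremePoints ℝ) (hW : W ∈ (nsPolytope X A).extremePoints ℝ)
    (h : ∀ x a, V x a = 0 → W x a = 0) : V = W := by
  have hVK := hV.1
  have hWK := hW.1
  have hev : ∀ᶠ t : ℝ in nhdsWithin 0 (Set.Ioi 0),
      ∀ x a, 0 ≤ V x a + t * (V x a - W x a) := by
    rw [Filter.eventually_all]
    intro x
    rw [Filter.eventually_all]
    intro a
    rcases (hVK.1 x a).eq_or_lt with h0 | h0
    · have hw := h x a h0.symm
      filter_upwards with t
      rw [← h0, hw]
      simp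
    · have hc : Filter.Tendsto (fun t : ℝ => V x a + t * (V x a - W x a)) (nhds 0)
          (nhds (V x a + 0 * (V x a - W x a))) := by
        apply Continuous.tendsto
        fun_prop
      have h1 : (0 : ℝ) < V x a + 0 * (V x a - W x a) := by simpa using h0
      have h2 := (hc.eventually (lt_mem_nhds h1)).filter_mono
        (nhdsWithin_le_nhds (s := Set.Ioi (0 : ℝ)))
      filter_upwards [h2] with t ht
      exact ht.le
  obtain ⟨t, ht, htpos⟩ := (hev.and self_mem_nhdsWithin).exists
  have ht0 : (0 : ℝ) < t := htpos
  set U : Box X A := fun x a => V x a + t * (V x a - W x a) with hU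
  have hUK : U ∈ nsPolytope X A := by
    refine ⟨ht, ?_, ?_⟩
    · intro x
      simp only [hU, Finset.sum_add_distrib, ← Finset.mul_sum, Finset.sum_sub_distrib,
        hVK.2.1 x, hWK.2.1 x]
      ring
    · intro S x x' hx a
      have e : ∀ y : ∀ i, X i, ∀ T : (∀ i, A i) → Prop, ∀ _ : DecidablePred T,
          (∑ a', if T a' then U y a' else 0) =
            (∑ a', if T a' then V y a' else 0) +
              t * ((∑ a', if T a' then V y a' else 0) - ∑ a', if T a' then W y a' else 0) := by
        intro y T _
        rw [← Finset.sum_sub_distrib, Finset.mul_sum, ← Finset.sum_add_distrib]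
        refine Finset.sum_congr rfl fun a' _ => ?_
        split_ifs <;> simp [hU]
      rw [e, e, hVK.2.2 S x x' hx a, hWK.2.2 S x x' hx a]
  have hseg : V ∈ openSegment ℝ U W := by
    refine ⟨1 / (1 + t), t / (1 + t), by positivity, by positivity, by field_simp, ?_⟩
    funext x a
    simp only [hU, Pi.add_apply, Pi.smul_apply, smul_eq_mul]
    field_simp
    ring
  have hUV : U = V := hV.2 hUK hWK hseg
  funext x a
  have h3 := congrFun (congrFun hUV x) a
  simp only [hU] at h3
  have h4 : t * (V x a - W x a) = 0 := by linarith
  rcases mul_eq_zero.1 h4 with h5 | h5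
  · exact absurd h5 ht0.ne'
  · linarith

instance finitePureDevice [∀ i, Fintype (X i)] : Finite (PureDevice X A) := by
  refine Finite.of_injective
    (fun V : PureDevice X A => {c : (∀ i, X i) × (∀ i, A i) | V.1 c.1 c.2 = 0}) ?_
  intro V W hVW
  refine Subtype.ext (eq_of_extreme_of_zeros V.2 W.2 fun x a hx => ?_)
  have : (x, a) ∈ {c : (∀ i, X i) × (∀ i, A i) | W.1 c.1 c.2 = 0} := by
    rw [← show _ = {c : (∀ i, X i) × (∀ i, A i) | W.1 c.1 c.2 = 0} from hVW]
    exact hx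
  exact this

noncomputable instance fintypePureDevice [∀ i, Fintype (X i)] : Fintype (PureDevice X A) :=
  Fintype.ofFinite _

variable [∀ i, Fintype (X i)]

/-- `w` is a pure-members ensemble of `P`: probabilities `w V` of the pure devices `V`, with
average `P`. Its members are the `V` with `w V ≠ 0`. -/
def IsPureEnsemble (P : Box X A) (w : PureDevice X A → ℝ) : Prop :=
  (∀ V, 0 ≤ w V) ∧ ∑ V, w V = 1 ∧ ∀ x a, ∑ V, w V * V.1 x a = P x a

/-- The minimal ensembles of `P`: no proper subset of the members is, with any new choice of
probabilities, an ensemble of `P`. -/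
def MinimalEnsemble (P : Box X A) : Type _ :=
  {w : PureDevice X A → ℝ // IsPureEnsemble P w ∧
    ∀ w', IsPureEnsemble P w' → ¬ Function.support w' ⊂ Function.support w}

instance finiteMinimalEnsemble (P : Box X A) : Finite (MinimalEnsemble P) := by
  classical
  refine Finite.of_injective (fun w : MinimalEnsemble P => Function.support w.1) ?_
  rintro ⟨w, hw, hmin⟩ ⟨w', hw', _⟩ hs
  have hs : Function.support w = Function.support w' := hs
  refine Subtype.ext ?_
  change w = w'
  by_contra hne
  have hex : ∃ V, w V < w' V := by
    by_contra! hle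
    refine hne (funext fun V => ?_)
    have := (Finset.sum_eq_sum_iff_of_le (s := Finset.univ) fun V _ => hle V).1
      (hw'.2.1.trans hw.2.1.symm)
    exact (this V (Finset.mem_univ V)).symm
  obtain ⟨V₁, hV₁⟩ := hex
  obtain ⟨V₀, hV₀, hle⟩ := Finset.exists_min_image
    (Finset.univ.filter fun V => w V < w' V) (fun V => w V / (w' V - w V))
    ⟨V₁, by simpa using hV₁⟩
  have hV₀' : w V₀ < w' V₀ := by simpa using hV₀
  set t := w V₀ / (w' V₀ - w V₀) with ht
  have ht0 : 0 ≤ t := div_nonneg (hw.1 V₀) (by linarith)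
  have hmem : V₀ ∈ Function.support w := by
    rw [hs, Function.mem_support]
    have := hw.1 V₀
    intro h0
    linarith
  refine hmin (fun V => w V + t * (w V - w' V)) ⟨?_, ?_, ?_⟩ ?_
  · intro V
    by_cases hV : w V < w' V
    · have h1 := hle V (by simpa using hV)
      have h2 : 0 < w' V - w V := by linarith
      have h3 : t * (w' V - w V) ≤ w V := (le_div_iff₀ h2).1 h1
      change 0 ≤ w V + t * (w V - w' V)
      linarith
    · have h1 : 0 ≤ t * (w V - w' V) := mul_nonneg ht0 (by linarith)
      have h2 := hw.1 V
      change 0 ≤ w V + t * (w V - w' V)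
      linarith
  · simp only [Finset.sum_add_distrib, ← Finset.mul_sum, Finset.sum_sub_distrib, hw.2.1, hw'.2.1]
    ring
  · intro x a
    have e : ∀ V : PureDevice X A, (w V + t * (w V - w' V)) * V.1 x a =
        w V * V.1 x a + t * (w V * V.1 x a - w' V * V.1 x a) := fun V => by ring
    simp only [e, Finset.sum_add_distrib, ← Finset.mul_sum, Finset.sum_sub_distrib,
      hw.2.2 x a, hw'.2.2 x a]
    ring
  · refine Set.ssubset_iff_subset_ne.2 ⟨?_, ?_⟩
    · intro V hV
      by_contra hn
      have h1 : w V = 0 := by simpa using hn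
      have h2 : w' V = 0 := by
        rw [hs] at hn
        simpa using hn
      apply hV
      simp [h1, h2]
    · intro heq
      rw [← heq] at hmem
      apply hmem
      have h2 : w' V₀ - w V₀ ≠ 0 := by linarith
      change w V₀ + t * (w V₀ - w' V₀) = 0
      rw [ht]
      field_simp
      ring

noncomputable instance fintypeMinimalEnsemble (P : Box X A) : Fintype (MinimalEnsemble P) :=
  Fintype.ofFinite _

/-- The complete extension `𝓔(P)(a, e | x, z) = p(e | z) V_e(a | x)`. The inputs `z` of the
extending system are exactly the minimal ensembles of `P`; its output `e` is the label of the
prepared member, namely the pure device itself. -/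
def completeExtension (P : Box X A) (z : MinimalEnsemble P) (e : PureDevice X A) : Box X A :=
  fun x a => z.1 e * e.1 x a

end Devices

/-! ### Entropic functions of finite distributions, logarithms to base 2 -/

section Entropy

variable {α β γ : Type*} [Fintype α] [Fintype β] [Fintype γ]

/-- Shannon entropy. -/
noncomputable def entropy (p : α → ℝ) : ℝ := -∑ a, p a * Real.logb 2 (p a)

/-- Conditional entropy `H(A|E) = H(AE) - H(E)`. -/
noncomputable def condEntropy (p : α → γ → ℝ) : ℝ :=
  entropy (fun t : α × γ => p t.1 t.2) - entropy (fun e => ∑ a, p a e)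

/-- `I(A:B)` of a tripartite distribution `p(a,b,e)`. -/
noncomputable def mutualInfo (p : α → β → γ → ℝ) : ℝ :=
  entropy (fun a => ∑ b, ∑ e, p a b e) + entropy (fun b => ∑ a, ∑ e, p a b e) -
    entropy (fun t : α × β => ∑ e, p t.1 t.2 e)

/-- `I(A:B|E) = H(A|E) + H(B|E) - H(AB|E)`. -/
noncomputable def condMutualInfo (p : α → β → γ → ℝ) : ℝ :=
  condEntropy (fun a e => ∑ b, p a b e) + condEntropy (fun b e => ∑ a, p a b e) -
    condEntropy (fun (t : α × β) e => p t.1 t.2 e)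

/-- A channel from `γ` to some finite alphabet `Fin n`. -/
abbrev Channel (γ : Type*) : Type _ := Σ n : ℕ, γ → stdSimplex ℝ (Fin n)

/-- `I(A:B↓E)`: infimum of `I(A:B|E')` over all channels from `E` to `E'`. -/
noncomputable def intrinsicInfo (p : α → β → γ → ℝ) : ℝ :=
  ⨅ Θ : Channel γ, condMutualInfo fun a b (e' : Fin Θ.1) => ∑ e, (Θ.2 e).1 e' * p a b e

/-- `I(A:B↓↓E)`: infimum of `I(A:B↓EU) + H(U)` over all channels from `ABE` to `U`. -/
noncomputable def reducedIntrinsicInfo (p : α → β → γ → ℝ) : ℝ :=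
  ⨅ Θ : Channel (α × β × γ),
    intrinsicInfo (fun a b (eu : γ × Fin Θ.1) => (Θ.2 (a, b, eu.1)).1 eu.2 * p a b eu.1) +
      entropy fun u : Fin Θ.1 => ∑ a, ∑ b, ∑ e, (Θ.2 (a, b, e)).1 u * p a b e

end Entropy

/-! ### Bipartite devices and squashing -/

/-- The two honest parties. -/
inductive Party
  | alice
  | bob
  deriving DecidableEq

instance fintypeParty : Fintype Party :=
  ⟨{.alice, .bob}, fun i => by cases i <;> simp⟩

section Bipartite

variable {X A : Party → Type*}

/-- The joint value with component `a` for Alice and `b` for Bob. -/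
def pair (a : A .alice) (b : A .bob) : ∀ i, A i
  | .alice => a
  | .bob => b

/-- The distribution of `ABE` after the direct measurement `x` (the inputs of Alice and Bob) and
the general measurement given by the distribution `p` of the input `z` of Eve. -/
def measured {Z E : Type*} [Fintype Z] (R : Z → E → Box X A) (x : ∀ i, X i) (p : stdSimplex ℝ Z) :
    A .alice → A .bob → E → ℝ :=
  fun a b e => ∑ z, p.1 z * R z e x (pair a b)

/-- Squashing of a function `M` of tripartite distributions: maximum over direct measurements of
Alice and Bob of the infimum over general measurements of Eve. -/
noncomputable def squash {Z E : Type*} [Fintype Z] (M : (A .alice → A .bob → E → ℝ) → ℝ)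
    (R : Z → E → Box X A) : ℝ :=
  ⨆ x : ∀ i, X i, ⨅ p : stdSimplex ℝ Z, M (measured R x p)

variable [∀ i, Fintype (X i)] [∀ i, Fintype (A i)]

/-- Squashed mutual information of the complete extension. -/
noncomputable def squashedMutualInfo (P : Box X A) : ℝ :=
  squash mutualInfo (completeExtension P)

/-- Squashed conditional mutual information of the complete extension. -/
noncomputable def squashedCondMutualInfo (P : Box X A) : ℝ :=
  squash condMutualInfo (completeExtension P)

/-- Squashed intrinsic information of the complete extension, i.e. squashed non-locality. -/
noncomputable def squashedNonlocality (P : Box X A) : ℝ :=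
  squash intrinsicInfo (completeExtension P)

/-- Squashed reduced intrinsic information of the complete extension. -/
noncomputable def squashedReducedIntrinsicInfo (P : Box X A) : ℝ :=
  squash reducedIntrinsicInfo (completeExtension P)

end Bipartite

/-! ### Classical-device states and the non-signaling norm

A classical-device state is a table `S z c e`, read as `S(c, e | z)`: a classical variable `c`
together with a device with input `z` and output `e`. -/

section NSNorm

/-- Operations of a distinguisher on classical-device states: read the classical variable `c`,
throw an auxiliary dice (which may depend on `c`), wire its outcome `r` into the input of the
device, and post-process all data stochastically to an outcome in `Fin outcomes`. Convex mixtures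
and general measurements are included by means of `r`; feeding the output of the device into the
input of a further dice is included in the stochastic post-processing. -/
structure DistinguishingOp (Z C E : Type*) where
  diceCard : ℕ
  outcomes : ℕ
  dice : C → stdSimplex ℝ (Fin diceCard)
  wire : C → Fin diceCard → Z
  post : C → Fin diceCard → E → stdSimplex ℝ (Fin outcomes)

variable {Z C E : Type*} [Fintype C] [Fintype E]

/-- The distribution obtained by applying `g` to the state `S`. -/
def DistinguishingOp.apply (g : DistinguishingOp Z C E) (S : Z → C → E → ℝ) :
    Fin g.outcomes → ℝ :=
  fun k => ∑ c, ∑ r, ∑ e, (g.dice c).1 r * S (g.wire c r) c e * (g.post c r e).1 k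

/-- The distance of two classical-device states in the non-signaling norm. -/
noncomputable def nsDist (S S' : Z → C → E → ℝ) : ℝ :=
  ⨆ g : DistinguishingOp Z C E, 1 / 2 * ∑ k, |g.apply S k - g.apply S' k|

end NSNorm

/-! ### Key distillation protocols -/

section Protocols

/-- A finite protocol with local operations and public communication for Alice, who holds a value
in `α`, and Bob, who holds a value in `β`. In even rounds Alice, in odd rounds Bob sends a public
message, drawn from a distribution which depends on the own data and on all earlier messages.
Finally each of them draws a key from the own data and all messages. (As all messages are
remembered, private randomness kept between rounds gives nothing more.) -/
structure LOPC (α β : Type*) where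
  rounds : ℕ
  msgCard : ℕ
  keyCard : ℕ
  msgA : (t : Fin rounds) → α → (Fin t → Fin msgCard) → stdSimplex ℝ (Fin msgCard)
  msgB : (t : Fin rounds) → β → (Fin t → Fin msgCard) → stdSimplex ℝ (Fin msgCard)
  keyA : α → (Fin rounds → Fin msgCard) → stdSimplex ℝ (Fin keyCard)
  keyB : β → (Fin rounds → Fin msgCard) → stdSimplex ℝ (Fin keyCard)

namespace LOPC

variable {α β : Type*} (L : LOPC α β)

/-- The possible public communications. -/
abbrev Transcript : Type := Fin L.rounds → Fin L.msgCard

/-- The probability of the public communication `q` given the data `a`, `b`. -/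
def transcriptProb (a : α) (b : β) (q : L.Transcript) : ℝ :=
  ∏ t : Fin L.rounds,
    if Even (t : ℕ) then (L.msgA t a fun s => q (s.castLE t.isLt.le)).1 (q t)
    else (L.msgB t b fun s => q (s.castLE t.isLt.le)).1 (q t)

/-- The probability of keys `sA`, `sB` and communication `q` given the data `a`, `b`. -/
def outProb (a : α) (b : β) (sA sB : Fin L.keyCard) (q : L.Transcript) : ℝ :=
  L.transcriptProb a b q * (L.keyA a q).1 sA * (L.keyB b q).1 sB

/-- The classical part of the output: both keys and the public communication. -/
abbrev Out : Type := Fin L.keyCard × Fin L.keyCard × L.Transcript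

end LOPC

variable (X A : Party → Type*)

/-- An MDLOPC operation on `N` copies: the same direct measurement (the inputs `x .alice` and
`x .bob`) on every copy, followed by an LOPC protocol on the outputs. -/
structure MDLOPC (N : ℕ) where
  x : ∀ i, X i
  lopc : LOPC (Fin N → A .alice) (Fin N → A .bob)

variable {X A}

/-- `P^{⊗N}`, a device of the `2N` parties `(n, alice)`, `(n, bob)`. -/
def copies (P : Box X A) (N : ℕ) :
    Box (fun j : Fin N × Party => X j.2) (fun j : Fin N × Party => A j.2) :=
  fun x a => ∏ n, P (fun i => x (n, i)) (fun i => a (n, i))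

variable [∀ i, Fintype (X i)] [∀ i, Fintype (A i)] {N : ℕ}

/-- The state after the operation `Λ` on the complete extension of `P^{⊗N}`: keys and public
communication, and the device of Eve. -/
noncomputable def MDLOPC.realState (Λ : MDLOPC X A N) (P : Box X A)
    (z : MinimalEnsemble (copies P N)) (c : Λ.lopc.Out)
    (e : PureDevice (fun j : Fin N × Party => X j.2) (fun j : Fin N × Party => A j.2)) : ℝ :=
  ∑ a : Fin N → A .alice, ∑ b : Fin N → A .bob,
    Λ.lopc.outProb a b c.1 c.2.1 c.2.2 *
      completeExtension (copies P N) z e (fun j => Λ.x j.2) (fun j => pair (a j.1) (b j.1) j.2)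

/-- The ideal state: a uniform, perfectly correlated key, in product with the communication and
the device of Eve of the real state. -/
noncomputable def MDLOPC.idealState (Λ : MDLOPC X A N) (P : Box X A)
    (z : MinimalEnsemble (copies P N)) (c : Λ.lopc.Out)
    (e : PureDevice (fun j : Fin N × Party => X j.2) (fun j : Fin N × Party => A j.2)) : ℝ :=
  (if c.1 = c.2.1 then 1 / (Λ.lopc.keyCard : ℝ) else 0) *
    ∑ sA, ∑ sB, Λ.realState P z (sA, sB, c.2.2) e

/-- `Λ = (Λ_N)` is a key distillation protocol for `P`: real and ideal states get arbitrarily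
close in the non-signaling norm. -/
def IsKeyDistillation (P : Box X A) (Λ : ∀ N, MDLOPC X A N) : Prop :=
  Filter.Tendsto (fun N => nsDist ((Λ N).realState P) ((Λ N).idealState P)) Filter.atTop (nhds 0)

/-- The rate `limsup (log₂ d_N) / N` of a protocol. -/
noncomputable def keyRate (Λ : ∀ N, MDLOPC X A N) : EReal :=
  Filter.limsup (fun N : ℕ => ((Real.logb 2 (Λ N).lopc.keyCard / N : ℝ) : EReal)) Filter.atTop

/-- The iid device-independent key rate `K_DI(P)`: the supremum of the rates of all key
distillation protocols for `P`. -/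
noncomputable def deviceIndependentKeyRate (P : Box X A) : EReal :=
  ⨆ (Λ : ∀ N, MDLOPC X A N) (_ : IsKeyDistillation P Λ), keyRate Λ

end Protocols

end NSDI

open NSDI

/-!
The squashed reduced intrinsic information is the smallest of the four quantities: a constant `U`,
keeping `E` and forgetting `E` are admissible choices of channels (`squash_le_squash`). So it is
enough to bound the rate of every protocol by it (`keyRate_le`).

*Reduction to independent copies.* The adversary may attack the `N` copies independently. A tensor
product of pure devices lies in the polytope of `2N` parties, so it splits into pure devices of that
polytope; hence a product of ensembles of `P` becomes a pure ensemble of `P^{⊗N}` whose members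
still reveal, by a post-processing, the members of the original ensembles. Every pure ensemble is a
mixture of minimal ones (`IsPureEnsemble.exists_mixture`), so this attack is available in the
complete extension (`exists_product_measurement`). It is not necessary that tensor products of pure
devices are pure. As the non-signaling norm dominates the statistical distance after a fixed
measurement (`half_sum_abs_le_nsDist`), what remains is a statement about secret key agreement from
`N` independent copies of one tripartite distribution.

*The one-shot bound* (`logb_card_key_le`). Let `S`, `T` be the keys in a set of `d` elements, `Q`
the communication, `U` drawn from `ABE`, and `F` drawn from `EU`. If the keys are `ε`-close to ideal
ones, then `H(S|QE) ≥ (1 - ε) log d - 2ε` and `H(S|TQF) ≤ 1 + ε log d`. Moreover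
`H(S|QE) ≤ H(S|QEU) + H(U) ≤ H(S|QF) + H(U)`, by submodularity and since `F` depends on `EU` only.
Therefore `(1 - 2ε) log d` is at most `I(S:T|QF) + H(U) + 1 + 2ε`.

*Monotonicity* (`condMutualInfo_local_le`). `I(S:T|QF) ≤ I(A:B|F)`. The probability of an output of
the protocol factorizes into a function of Alice's and a function of Bob's data. So the protocol
maps the reference `p(a,f) p(b,f) / p(f)`, relative to which `I(A:B|F)` is the relative entropy of
`p(a,b,f)`, to a reference of product form for every `q` and `f`. Relative entropy does not
increase, and `I(S:T|QF)` is the smallest relative entropy with respect to references of product form.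

Finally, entropies of independent copies add up, so the one-shot bound divided by `N` gives the rate
bound. The error terms are uniform over the finitely many inputs of Alice and Bob, which may depend
on `N`.
-/

namespace NSDI

/-! ### Gibbs' inequality and entropies of random variables -/

section Gibbs

variable {ι α β γ : Type*} [Fintype ι] [Fintype α] [Fintype β] [Fintype γ]

/-- Gibbs' inequality. The support condition is not automatic, as `logb 2 0 = 0`. -/
theorem sum_mul_logb_le_of_sum_le {p r : ι → ℝ} (hp : ∀ i, 0 ≤ p i) (hr : ∀ i, 0 ≤ r i)
    (hpr : ∀ i, p i ≠ 0 → r i ≠ 0) (hs : ∑ i, r i ≤ ∑ i, p i) :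
    ∑ i, p i * Real.logb 2 (r i) ≤ ∑ i, p i * Real.logb 2 (p i) := by
  have key : ∀ i, p i * Real.log (r i) ≤ p i * Real.log (p i) + (r i - p i) := by
    intro i
    rcases (hp i).eq_or_lt with h | h
    · simp [← h, hr i]
    · have hr' : 0 < r i := lt_of_le_of_ne (hr i) (hpr i h.ne').symm
      have h1 := Real.log_le_sub_one_of_pos (div_pos hr' h)
      rw [Real.log_div hr'.ne' h.ne'] at h1
      have h2 := mul_le_mul_of_nonneg_left h1 h.le
      have h3 : p i * (r i / p i - 1) = r i - p i := by field_simp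
      linarith
  have h := Finset.sum_le_sum fun i (_ : i ∈ Finset.univ) => key i
  rw [Finset.sum_add_distrib, Finset.sum_sub_distrib] at h
  simp only [Real.logb, ← mul_div_assoc, ← Finset.sum_div]
  exact div_le_div_of_nonneg_right (by linarith) (Real.log_nonneg (by norm_num))

theorem sum_ne_zero_of_ne_zero {f : ι → ℝ} (hf : ∀ i, 0 ≤ f i) (i : ι) (h : f i ≠ 0) :
    ∑ i, f i ≠ 0 := by
  intro h0
  exact h ((Finset.sum_eq_zero_iff_of_nonneg fun i _ => hf i).1 h0 i (Finset.mem_univ i))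

theorem condEntropy_eq_sum {p : α → γ → ℝ} (hp : ∀ a c, 0 ≤ p a c) :
    condEntropy p = -∑ a, ∑ c, p a c * Real.logb 2 (p a c / ∑ a', p a' c) := by
  have h : ∀ a c, p a c * Real.logb 2 (p a c / ∑ a', p a' c) =
      p a c * Real.logb 2 (p a c) - p a c * Real.logb 2 (∑ a', p a' c) := by
    intro a c
    rcases eq_or_ne (p a c) 0 with h | h
    · simp [h]
    · rw [Real.logb_div h (sum_ne_zero_of_ne_zero (fun a => hp a c) a h), mul_sub]
  simp only [condEntropy, entropy, h, Finset.sum_sub_distrib, Fintype.sum_prod_type]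
  rw [Finset.sum_comm (f := fun a c => p a c * Real.logb 2 (∑ a', p a' c))]
  simp only [← Finset.sum_mul]
  ring

/-- The conditional entropy is at most every conditional cross entropy. -/
theorem condEntropy_le {p r : α → γ → ℝ} (hp : ∀ a c, 0 ≤ p a c) (hr : ∀ a c, 0 ≤ r a c)
    (hpr : ∀ a c, p a c ≠ 0 → r a c ≠ 0) (hs : ∀ c, ∑ a, r a c ≤ 1) :
    condEntropy p ≤ -∑ a, ∑ c, p a c * Real.logb 2 (r a c) := by
  have hm : ∀ c, 0 ≤ ∑ a, p a c := fun c => Finset.sum_nonneg fun a _ => hp a c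
  have hne : ∀ a c, p a c ≠ 0 → ∑ a', p a' c ≠ 0 :=
    fun a c h => sum_ne_zero_of_ne_zero (fun a => hp a c) a h
  have h := sum_mul_logb_le_of_sum_le (p := fun t : α × γ => p t.1 t.2)
    (r := fun t => r t.1 t.2 * ∑ a, p a t.2) (fun t => hp _ _)
    (fun t => mul_nonneg (hr _ _) (hm _)) (fun t ht => mul_ne_zero (hpr _ _ ht) (hne _ _ ht)) (by
      rw [Fintype.sum_prod_type_right, Fintype.sum_prod_type_right]
      refine Finset.sum_le_sum fun c _ => ?_
      dsimp only
      rw [← Finset.sum_mul]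
      exact mul_le_of_le_one_left (hm c) (hs c))
  rw [condEntropy_eq_sum hp, neg_le_neg_iff]
  simp only [Fintype.sum_prod_type] at h
  have e1 : ∀ a c, p a c * Real.logb 2 (p a c / ∑ a', p a' c) =
      p a c * Real.logb 2 (p a c) - p a c * Real.logb 2 (∑ a', p a' c) := by
    intro a c
    rcases eq_or_ne (p a c) 0 with h | h
    · simp [h]
    · rw [Real.logb_div h (hne a c h), mul_sub]
  have e2 : ∀ a c, p a c * Real.logb 2 (r a c * ∑ a', p a' c) =
      p a c * Real.logb 2 (r a c) + p a c * Real.logb 2 (∑ a', p a' c) := by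
    intro a c
    rcases eq_or_ne (p a c) 0 with h | h
    · simp [h]
    · rw [Real.logb_mul (hpr a c h) (hne a c h), mul_add]
  simp only [e2, Finset.sum_add_distrib] at h
  simp only [e1, Finset.sum_sub_distrib]
  linarith

theorem entropy_nonneg {p : α → ℝ} (hp : ∀ a, 0 ≤ p a) (hs : ∑ a, p a = 1) : 0 ≤ entropy p := by
  rw [entropy, neg_nonneg]
  refine Finset.sum_nonpos fun a _ => mul_nonpos_of_nonneg_of_nonpos (hp a) ?_
  refine Real.logb_nonpos (by norm_num) (hp a) ?_
  rw [← hs]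
  exact Finset.single_le_sum (fun a _ => hp a) (Finset.mem_univ a)

theorem entropy_comp_equiv (e : α ≃ β) (p : β → ℝ) : entropy (fun a => p (e a)) = entropy p := by
  rw [entropy, entropy]
  exact congrArg _ (Equiv.sum_comp e fun b => p b * Real.logb 2 (p b))

end Gibbs

section Law

variable {Ω α β γ : Type*} [Fintype Ω] [Fintype α] [Fintype β] [Fintype γ]

open Classical in
/-- The distribution of the random variable `X` on the finite space `Ω` with weights `μ`. -/
noncomputable def law (μ : Ω → ℝ) (X : Ω → α) (a : α) : ℝ :=
  ∑ ω, if X ω = a then μ ω else 0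

/-- The entropy of the random variable `X`. -/
noncomputable def rvEntropy (μ : Ω → ℝ) (X : Ω → α) : ℝ := entropy (law μ X)

variable {μ : Ω → ℝ}

theorem law_nonneg {α : Type*} (hμ : ∀ ω, 0 ≤ μ ω) (X : Ω → α) (a : α) : 0 ≤ law μ X a :=
  Finset.sum_nonneg fun ω _ => by split_ifs <;> simp [hμ]

theorem sum_law_mul (X : Ω → α) (g : α → ℝ) :
    ∑ a, law μ X a * g a = ∑ ω, μ ω * g (X ω) := by
  classical
  simp only [law, Finset.sum_mul, ite_mul, zero_mul]
  rw [Finset.sum_comm]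
  simp

theorem sum_law (X : Ω → α) : ∑ a, law μ X a = ∑ ω, μ ω := by
  simpa using sum_law_mul (μ := μ) X fun _ => 1

theorem sum_law_pair_right {α β : Type*} [Fintype β] (X : Ω → α) (Y : Ω → β) (a : α) :
    ∑ b, law μ (fun ω => (X ω, Y ω)) (a, b) = law μ X a := by
  classical
  simp only [law]
  rw [Finset.sum_comm]
  refine Finset.sum_congr rfl fun ω _ => ?_
  simp [ite_and]

theorem sum_law_pair_left {α β : Type*} [Fintype α] (X : Ω → α) (Y : Ω → β) (b : β) :
    ∑ a, law μ (fun ω => (X ω, Y ω)) (a, b) = law μ Y b := by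
  classical
  simp only [law]
  rw [Finset.sum_comm]
  refine Finset.sum_congr rfl fun ω _ => ?_
  by_cases h : Y ω = b <;> simp [h]

/-- The entropy as an expectation on `Ω`, which makes entropies of different variables comparable
pointwise. -/
theorem rvEntropy_eq (X : Ω → α) :
    rvEntropy μ X = -∑ ω, μ ω * Real.logb 2 (law μ X (X ω)) := by
  rw [rvEntropy, entropy, sum_law_mul X fun a => Real.logb 2 (law μ X a)]

/-- A random variable which is determined by another one has at most its entropy. -/
theorem rvEntropy_le_of_determined (hμ : ∀ ω, 0 ≤ μ ω) {X : Ω → α} {Y : Ω → β}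
    (h : ∀ ω ω', Y ω = Y ω' → X ω = X ω') : rvEntropy μ X ≤ rvEntropy μ Y := by
  classical
  rw [rvEntropy_eq, rvEntropy_eq, neg_le_neg_iff]
  refine Finset.sum_le_sum fun ω _ => ?_
  rcases (hμ ω).eq_or_lt with h0 | h0
  · simp [← h0]
  · have h1 : μ ω ≤ law μ Y (Y ω) := by
      have := Finset.single_le_sum (f := fun ω' => if Y ω' = Y ω then μ ω' else 0)
        (fun ω' _ => by split_ifs <;> simp [hμ]) (Finset.mem_univ ω)
      simpa [law] using this
    refine mul_le_mul_of_nonneg_left (Real.logb_le_logb_of_le (by norm_num) (by linarith) ?_) h0.le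
    refine Finset.sum_le_sum fun ω' _ => ?_
    split_ifs with h2 h3
    · exact le_rfl
    · exact absurd (h _ _ h2) h3
    · exact hμ ω'
    · exact le_rfl

/-- The entropy depends only on the partition of `Ω` by the values of the random variable. -/
theorem rvEntropy_congr (hμ : ∀ ω, 0 ≤ μ ω) {X : Ω → α} {Y : Ω → β}
    (h : ∀ ω ω', X ω = X ω' ↔ Y ω = Y ω') : rvEntropy μ X = rvEntropy μ Y :=
  le_antisymm (rvEntropy_le_of_determined hμ fun ω ω' => (h ω ω').2)
    (rvEntropy_le_of_determined hμ fun ω ω' => (h ω ω').1)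

theorem condEntropy_law (X : Ω → α) (Z : Ω → γ) :
    condEntropy (fun a c => law μ (fun ω => (X ω, Z ω)) (a, c)) =
      rvEntropy μ (fun ω => (X ω, Z ω)) - rvEntropy μ Z := by
  simp only [condEntropy, sum_law_pair_left]
  rfl

end Law

section Submodularity

variable {Ω α β γ : Type*} [Fintype Ω] [Fintype α] [Fintype β] [Fintype γ]

/-- Conditioning on `Y` in addition to `Z` does not increase the entropy of `X`, for tables. -/
theorem condEntropy_prod_le {p : α → β → γ → ℝ} (hp : ∀ a b c, 0 ≤ p a b c) :
    condEntropy (fun a (t : β × γ) => p a t.1 t.2) ≤ condEntropy (fun a c => ∑ b, p a b c) := by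
  have hm : ∀ a c, 0 ≤ ∑ b, p a b c := fun a c => Finset.sum_nonneg fun b _ => hp a b c
  rw [condEntropy_eq_sum hm]
  refine (condEntropy_le (fun a t => hp a t.1 t.2)
    (r := fun a (t : β × γ) => (∑ b, p a b t.2) / ∑ a', ∑ b, p a' b t.2)
    (fun a t => div_nonneg (hm _ _) (Finset.sum_nonneg fun a' _ => hm _ _)) ?_ ?_).trans_eq ?_
  · intro a t ht
    have h1 := sum_ne_zero_of_ne_zero (fun b => hp a b t.2) t.1 ht
    exact div_ne_zero h1 (sum_ne_zero_of_ne_zero (fun a => hm a t.2) a h1)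
  · intro t
    rw [← Finset.sum_div]
    exact div_self_le_one _
  · congr 1
    refine Finset.sum_congr rfl fun a _ => ?_
    rw [Fintype.sum_prod_type_right]
    simp only [← Finset.sum_mul]

theorem condMutualInfo_nonneg {p : α → β → γ → ℝ} (hp : ∀ a b c, 0 ≤ p a b c) :
    0 ≤ condMutualInfo p := by
  have h := condEntropy_prod_le hp
  have e : entropy (fun t : (α × β) × γ => p t.1.1 t.1.2 t.2) =
      entropy fun t : α × β × γ => p t.1 t.2.1 t.2.2 :=
    entropy_comp_equiv (Equiv.prodAssoc α β γ) fun t => p t.1 t.2.1 t.2.2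
  have e' : ∀ c, ∑ b, ∑ a, p a b c = ∑ a, ∑ b, p a b c := fun c => Finset.sum_comm
  simp only [condEntropy] at h
  simp only [condMutualInfo, condEntropy, Fintype.sum_prod_type, e, e']
  linarith

variable {μ : Ω → ℝ}

theorem sum_law_triple_middle {α γ : Type*} (X : Ω → α) (Y : Ω → β) (Z : Ω → γ) (a : α) (c : γ) :
    ∑ b, law μ (fun ω => (X ω, Y ω, Z ω)) (a, b, c) = law μ (fun ω => (X ω, Z ω)) (a, c) := by
  classical
  simp only [law]
  rw [Finset.sum_comm]
  refine Finset.sum_congr rfl fun ω _ => ?_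
  by_cases h : X ω = a <;> by_cases h' : Z ω = c <;> simp [h, h']

theorem condMutualInfo_law (X : Ω → α) (Y : Ω → β) (Z : Ω → γ) :
    condMutualInfo (fun a b c => law μ (fun ω => (X ω, Y ω, Z ω)) (a, b, c)) =
      rvEntropy μ (fun ω => (X ω, Z ω)) + rvEntropy μ (fun ω => (Y ω, Z ω)) -
        rvEntropy μ (fun ω => (X ω, Y ω, Z ω)) - rvEntropy μ Z := by
  have e : entropy (fun t : (α × β) × γ =>
      law μ (fun ω => (X ω, Y ω, Z ω)) (t.1.1, t.1.2, t.2)) =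
      rvEntropy μ (fun ω => (X ω, Y ω, Z ω)) :=
    entropy_comp_equiv (Equiv.prodAssoc α β γ) (law μ fun ω => (X ω, Y ω, Z ω))
  have e' : ∀ c, ∑ b, law μ (fun ω => (Y ω, Z ω)) (b, c) = law μ Z c :=
    fun c => sum_law_pair_left Y Z c
  have e'' : ∀ c, ∑ a, law μ (fun ω => (X ω, Z ω)) (a, c) = law μ Z c :=
    fun c => sum_law_pair_left X Z c
  simp only [condMutualInfo, condEntropy, Fintype.sum_prod_type, sum_law_triple_middle, e, e', e'',
    sum_law_pair_left]
  simp only [rvEntropy]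
  ring

/-- Submodularity of the entropy. -/
theorem rvEntropy_submodular (hμ : ∀ ω, 0 ≤ μ ω) (X : Ω → α) (Y : Ω → β) (Z : Ω → γ) :
    rvEntropy μ (fun ω => (X ω, Y ω, Z ω)) + rvEntropy μ Z ≤
      rvEntropy μ (fun ω => (X ω, Z ω)) + rvEntropy μ (fun ω => (Y ω, Z ω)) := by
  have h := condMutualInfo_nonneg (p := fun a b c => law μ (fun ω => (X ω, Y ω, Z ω)) (a, b, c))
    fun a b c => law_nonneg hμ _ _
  rw [condMutualInfo_law] at h
  linarith

theorem rvEntropy_pair_le (hμ : ∀ ω, 0 ≤ μ ω) (h1 : ∑ ω, μ ω = 1) (X : Ω → α) (Y : Ω → β) :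
    rvEntropy μ (fun ω => (X ω, Y ω)) ≤ rvEntropy μ X + rvEntropy μ Y := by
  have h := rvEntropy_submodular hμ X Y fun _ => ()
  have e0 : rvEntropy μ (fun _ => ()) = 0 := by
    simp [rvEntropy_eq, law, h1]
  rw [e0, rvEntropy_congr hμ (X := fun ω => (X ω, Y ω, ())) (Y := fun ω => (X ω, Y ω)) (by simp),
    rvEntropy_congr hμ (X := fun ω => (X ω, ())) (Y := X) (by simp),
    rvEntropy_congr hμ (X := fun ω => (Y ω, ())) (Y := Y) (by simp)] at h
  linarith

/-- If `F` is drawn from a channel applied to a function `g` of `W`, the conditional entropy of `F`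
given `W` is an average which involves only the joint distribution of `g W` and `F`. -/
theorem rvEntropy_channel {β : Type*} {ν : Ω → ℝ} (hν : ∀ ω, 0 ≤ ν ω) (κ : β → γ → ℝ)
    (hκ : ∀ b c, 0 ≤ κ b c) (hκ1 : ∀ b, ∑ c, κ b c = 1) (W : Ω → α) (g : α → β) :
    rvEntropy (fun t : Ω × γ => ν t.1 * κ (g (W t.1)) t.2) (fun t => (W t.1, t.2)) =
      rvEntropy (fun t : Ω × γ => ν t.1 * κ (g (W t.1)) t.2) (fun t => W t.1) -
        ∑ ω, ∑ c, ν ω * κ (g (W ω)) c * Real.logb 2 (κ (g (W ω)) c) := by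
  classical
  set μ : Ω × γ → ℝ := fun t => ν t.1 * κ (g (W t.1)) t.2 with hμ
  have hμ0 : ∀ t, 0 ≤ μ t := fun t => mul_nonneg (hν _) (hκ _ _)
  have h1 : ∀ w, law μ (fun t => W t.1) w = law ν W w := by
    intro w
    simp only [law, Fintype.sum_prod_type, hμ]
    refine Finset.sum_congr rfl fun ω _ => ?_
    by_cases h : W ω = w <;> simp [h, ← Finset.mul_sum, hκ1]
  have h2 : ∀ w c, law μ (fun t => (W t.1, t.2)) (w, c) = law ν W w * κ (g w) c := by
    intro w c
    simp only [law, Fintype.sum_prod_type, hμ, Finset.sum_mul, Prod.mk.injEq]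
    refine Finset.sum_congr rfl fun ω _ => ?_
    by_cases h : W ω = w <;> simp [h]
  rw [rvEntropy_eq, rvEntropy_eq, neg_sub_left, neg_inj, Fintype.sum_prod_type,
    Fintype.sum_prod_type, ← Finset.sum_add_distrib]
  refine Finset.sum_congr rfl fun ω _ => ?_
  rw [← Finset.sum_add_distrib]
  refine Finset.sum_congr rfl fun c _ => ?_
  rw [h1, h2]
  rcases eq_or_ne (μ (ω, c)) 0 with h | h
  · simp only [hμ] at h
    simp [hμ, h]
  · have h' : ν ω * κ (g (W ω)) c ≠ 0 := h
    have hl : law ν W (W ω) ≠ 0 := by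
      refine sum_ne_zero_of_ne_zero (fun ω' => ?_) ω ?_
      · split_ifs <;> simp [hν]
      · simpa using left_ne_zero_of_mul h'
    rw [Real.logb_mul hl (right_ne_zero_of_mul h')]
    ring

end Submodularity

/-! ### Monotonicity under local operations and public communication -/

section Monotonicity

variable {α β φ σ τ κ ω : Type*} [Fintype α] [Fintype β] [Fintype φ] [Fintype σ] [Fintype τ]
  [Fintype κ] [Fintype ω]

theorem condMutualInfo_eq_sum (p : α → β → φ → ℝ) :
    condMutualInfo p = ∑ a, ∑ b, ∑ c, p a b c *
      (Real.logb 2 (p a b c) - Real.logb 2 (∑ b', p a b' c) - Real.logb 2 (∑ a', p a' b c) +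
        Real.logb 2 (∑ a', ∑ b', p a' b' c)) := by
  have e' : ∀ c, ∑ b, ∑ a, p a b c = ∑ a, ∑ b, p a b c := fun c => Finset.sum_comm
  simp only [condMutualInfo, condEntropy, entropy, Fintype.sum_prod_type, e', mul_add, mul_sub,
    Finset.sum_add_distrib, Finset.sum_sub_distrib]
  have h1 : ∑ a, ∑ b, ∑ c, p a b c * Real.logb 2 (∑ b', p a b' c) =
      ∑ a, ∑ c, (∑ b, p a b c) * Real.logb 2 (∑ b', p a b' c) := by
    refine Finset.sum_congr rfl fun a _ => ?_
    rw [Finset.sum_comm]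
    simp only [Finset.sum_mul]
  have h2 : ∑ a, ∑ b, ∑ c, p a b c * Real.logb 2 (∑ a', p a' b c) =
      ∑ b, ∑ c, (∑ a, p a b c) * Real.logb 2 (∑ a', p a' b c) := by
    rw [Finset.sum_comm]
    refine Finset.sum_congr rfl fun b _ => ?_
    rw [Finset.sum_comm]
    simp only [Finset.sum_mul]
  have h3 : ∑ a, ∑ b, ∑ c, p a b c * Real.logb 2 (∑ a', ∑ b', p a' b' c) =
      ∑ c, (∑ a, ∑ b, p a b c) * Real.logb 2 (∑ a', ∑ b', p a' b' c) := by
    simp only [Finset.sum_mul]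
    rw [Finset.sum_comm (t := Finset.univ (α := α))]
    refine Finset.sum_congr rfl fun a _ => ?_
    rw [Finset.sum_comm]
  rw [h1, h2, h3]
  ring

/-- The conditional mutual information is the smallest relative entropy with respect to tables
`u s w * v t w`, in which the two parties are independent given the third one. -/
theorem condMutualInfo_le_relEntropy {P : σ → τ → ω → ℝ} {u : σ → ω → ℝ} {v : τ → ω → ℝ}
    (hP : ∀ s t w, 0 ≤ P s t w) (hu : ∀ s w, 0 ≤ u s w) (hv : ∀ t w, 0 ≤ v t w)
    (hPu : ∀ s t w, P s t w ≠ 0 → u s w ≠ 0) (hPv : ∀ s t w, P s t w ≠ 0 → v t w ≠ 0)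
    (hs : ∑ s, ∑ t, ∑ w, u s w * v t w ≤ ∑ s, ∑ t, ∑ w, P s t w) :
    condMutualInfo P ≤ ∑ s, ∑ t, ∑ w, P s t w *
      (Real.logb 2 (P s t w) - Real.logb 2 (u s w) - Real.logb 2 (v t w)) := by
  set S : σ → ω → ℝ := fun s w => ∑ t, P s t w
  set T : τ → ω → ℝ := fun t w => ∑ s, P s t w
  set W : ω → ℝ := fun w => ∑ s, ∑ t, P s t w
  have hS0 : ∀ s w, 0 ≤ S s w := fun s w => Finset.sum_nonneg fun t _ => hP s t w
  have hT0 : ∀ t w, 0 ≤ T t w := fun t w => Finset.sum_nonneg fun s _ => hP s t w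
  have hW0 : ∀ w, 0 ≤ W w := fun w => Finset.sum_nonneg fun s _ => hS0 s w
  have hTW : ∀ w, ∑ t, T t w = W w := fun w => Finset.sum_comm
  have hSW : ∀ s w, S s w ≠ 0 → W w ≠ 0 :=
    fun s w h => sum_ne_zero_of_ne_zero (fun s => hS0 s w) s h
  have hTW' : ∀ t w, T t w ≠ 0 → W w ≠ 0 := by
    intro t w h
    rw [← hTW]
    exact sum_ne_zero_of_ne_zero (fun t => hT0 t w) t h
  have hSu : ∀ s w, S s w ≠ 0 → u s w ≠ 0 := by
    intro s w h
    obtain ⟨t, -, ht⟩ := Finset.exists_ne_zero_of_sum_ne_zero h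
    exact hPu s t w ht
  have hTv : ∀ t w, T t w ≠ 0 → v t w ≠ 0 := by
    intro t w h
    obtain ⟨s, -, hs⟩ := Finset.exists_ne_zero_of_sum_ne_zero h
    exact hPv s t w hs
  -- `P'` makes the parties independent given `w` and has the same two-party marginals as `P`.
  set P' : σ × τ × ω → ℝ := fun i => S i.1 i.2.2 * T i.2.1 i.2.2 / W i.2.2 with hP'
  have hP'0 : ∀ i, 0 ≤ P' i := fun i => div_nonneg (mul_nonneg (hS0 _ _) (hT0 _ _)) (hW0 _)
  have m1 : ∀ h : σ → ω → ℝ, ∑ i, P' i * h i.1 i.2.2 = ∑ s, ∑ t, ∑ w, P s t w * h s w := by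
    intro h
    simp only [Fintype.sum_prod_type]
    refine Finset.sum_congr rfl fun s _ => ?_
    refine Finset.sum_comm.trans (Eq.trans ?_ Finset.sum_comm)
    refine Finset.sum_congr rfl fun w _ => ?_
    rw [← Finset.sum_mul, ← Finset.sum_mul]
    congr 1
    simp only [hP']
    rw [← Finset.sum_div, ← Finset.mul_sum, hTW]
    rcases eq_or_ne (W w) 0 with h0 | h0
    · by_contra hne
      exact hSW s w (fun h1 => hne (by change _ = S s w; simp [h0, h1])) h0
    · exact mul_div_cancel_right₀ _ h0
  have m2 : ∀ h : τ → ω → ℝ, ∑ i, P' i * h i.2.1 i.2.2 = ∑ s, ∑ t, ∑ w, P s t w * h t w := by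
    intro h
    simp only [Fintype.sum_prod_type]
    refine Finset.sum_comm.trans (Eq.trans ?_ Finset.sum_comm)
    refine Finset.sum_congr rfl fun t _ => ?_
    refine Finset.sum_comm.trans (Eq.trans ?_ Finset.sum_comm)
    refine Finset.sum_congr rfl fun w _ => ?_
    rw [← Finset.sum_mul, ← Finset.sum_mul]
    congr 1
    simp only [hP']
    rw [← Finset.sum_div, ← Finset.sum_mul]
    change W w * T t w / W w = T t w
    rcases eq_or_ne (W w) 0 with h0 | h0
    · by_contra hne
      exact hTW' t w (fun h1 => hne (by simp [h0, h1])) h0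
    · exact mul_div_cancel_left₀ _ h0
  have hfac : ∀ i, P' i ≠ 0 → S i.1 i.2.2 ≠ 0 ∧ T i.2.1 i.2.2 ≠ 0 ∧ W i.2.2 ≠ 0 := by
    intro i hi
    simp only [hP', div_ne_zero_iff, mul_ne_zero_iff] at hi
    exact ⟨hi.1.1, hi.1.2, hi.2⟩
  have key := sum_mul_logb_le_of_sum_le (p := P')
    (r := fun i => u i.1 i.2.2 * v i.2.1 i.2.2) hP'0
    (fun i => mul_nonneg (hu _ _) (hv _ _))
    (fun i hi => mul_ne_zero (hSu _ _ (hfac i hi).1) (hTv _ _ (hfac i hi).2.1)) (by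
      have := m1 fun _ _ => 1
      simp only [mul_one] at this
      rw [this]
      simpa only [Fintype.sum_prod_type] using hs)
  have e1 : ∀ i, P' i * Real.logb 2 (u i.1 i.2.2 * v i.2.1 i.2.2) =
      P' i * Real.logb 2 (u i.1 i.2.2) + P' i * Real.logb 2 (v i.2.1 i.2.2) := by
    intro i
    rcases eq_or_ne (P' i) 0 with h | h
    · simp [h]
    · rw [Real.logb_mul (hSu _ _ (hfac i h).1) (hTv _ _ (hfac i h).2.1), mul_add]
  have e2 : ∀ i, P' i * Real.logb 2 (P' i) =
      P' i * (Real.logb 2 (S i.1 i.2.2) - Real.logb 2 (W i.2.2)) +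
        P' i * Real.logb 2 (T i.2.1 i.2.2) := by
    intro i
    rcases eq_or_ne (P' i) 0 with h | h
    · simp [h]
    · obtain ⟨h1, h2, h3⟩ := hfac i h
      simp only [hP']
      rw [Real.logb_div (mul_ne_zero h1 h2) h3, Real.logb_mul h1 h2]
      ring
  simp only [e1, e2, Finset.sum_add_distrib] at key
  rw [m1 fun s w => Real.logb 2 (u s w), m2 fun t w => Real.logb 2 (v t w),
    m1 fun s w => Real.logb 2 (S s w) - Real.logb 2 (W w),
    m2 fun t w => Real.logb 2 (T t w)] at key
  rw [condMutualInfo_eq_sum]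
  simp only [mul_add, mul_sub, Finset.sum_add_distrib, Finset.sum_sub_distrib] at key ⊢
  linarith

/-- A public communication `q` together with local outputs `s` and `t`, produced with
probabilities of the product form `f a q s * g b q t`, does not increase the conditional mutual
information. The reason is that the reference table `p(a,c) p(b,c) / p(c)` is mapped to a table in
which the outputs are again independent given `q` and `c`. -/
theorem condMutualInfo_local_le {p : α → β → φ → ℝ} (hp : ∀ a b c, 0 ≤ p a b c)
    {f : α → κ → σ → ℝ} {g : β → κ → τ → ℝ} (hf : ∀ a q s, 0 ≤ f a q s)
    (hg : ∀ b q t, 0 ≤ g b q t) (hfg : ∀ a b, ∑ s, ∑ t, ∑ q, f a q s * g b q t = 1) :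
    condMutualInfo (fun s t (w : κ × φ) =>
        ∑ a, ∑ b, f a w.1 s * g b w.1 t * p a b w.2) ≤ condMutualInfo p := by
  set P : σ → τ → κ × φ → ℝ := fun s t w => ∑ a, ∑ b, f a w.1 s * g b w.1 t * p a b w.2 with hP
  set S : α → φ → ℝ := fun a c => ∑ b, p a b c
  set T : β → φ → ℝ := fun b c => ∑ a, p a b c
  set W : φ → ℝ := fun c => ∑ a, ∑ b, p a b c
  -- `u s w * v t w` is the image of the reference table `S a c * T b c / W c`.
  set u : σ → κ × φ → ℝ := fun s w => ∑ a, f a w.1 s * S a w.2 with hu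
  set v : τ → κ × φ → ℝ := fun t w => ∑ b, g b w.1 t * T b w.2 / W w.2 with hv
  have hS0 : ∀ a c, 0 ≤ S a c := fun a c => Finset.sum_nonneg fun b _ => hp a b c
  have hT0 : ∀ b c, 0 ≤ T b c := fun b c => Finset.sum_nonneg fun a _ => hp a b c
  have hW0 : ∀ c, 0 ≤ W c := fun c => Finset.sum_nonneg fun a _ => hS0 a c
  have hP0 : ∀ s t w, 0 ≤ P s t w := fun s t w => Finset.sum_nonneg fun a _ =>
    Finset.sum_nonneg fun b _ => mul_nonneg (mul_nonneg (hf _ _ _) (hg _ _ _)) (hp _ _ _)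
  have hu0' : ∀ a s (w : κ × φ), 0 ≤ f a w.1 s * S a w.2 :=
    fun a s w => mul_nonneg (hf _ _ _) (hS0 _ _)
  have hv0' : ∀ b t (w : κ × φ), 0 ≤ g b w.1 t * T b w.2 / W w.2 :=
    fun b t w => div_nonneg (mul_nonneg (hg _ _ _) (hT0 _ _)) (hW0 _)
  have hu0 : ∀ s w, 0 ≤ u s w := fun s w => Finset.sum_nonneg fun a _ => hu0' a s w
  have hv0 : ∀ t w, 0 ≤ v t w := fun t w => Finset.sum_nonneg fun b _ => hv0' b t w
  have hne : ∀ a b c, p a b c ≠ 0 → S a c ≠ 0 ∧ T b c ≠ 0 ∧ W c ≠ 0 := by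
    intro a b c h
    have h1 : S a c ≠ 0 := sum_ne_zero_of_ne_zero (fun b => hp a b c) b h
    exact ⟨h1, sum_ne_zero_of_ne_zero (fun a => hp a b c) a h,
      sum_ne_zero_of_ne_zero (fun a => hS0 a c) a h1⟩
  have huv : ∀ a b q s t c, f a q s * g b q t * p a b c ≠ 0 →
      u s (q, c) ≠ 0 ∧ v t (q, c) ≠ 0 ∧ P s t (q, c) ≠ 0 := by
    intro a b q s t c h
    have h1 := right_ne_zero_of_mul h
    have h2 := left_ne_zero_of_mul (left_ne_zero_of_mul h)
    have h3 := right_ne_zero_of_mul (left_ne_zero_of_mul h)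
    obtain ⟨h4, h5, h6⟩ := hne a b c h1
    refine ⟨sum_ne_zero_of_ne_zero (fun a => hu0' a s (q, c)) a (mul_ne_zero h2 h4),
      sum_ne_zero_of_ne_zero (fun b => hv0' b t (q, c)) b (div_ne_zero (mul_ne_zero h3 h5) h6), ?_⟩
    refine sum_ne_zero_of_ne_zero (fun a => Finset.sum_nonneg fun b _ =>
      mul_nonneg (mul_nonneg (hf a q s) (hg b q t)) (hp a b c)) a ?_
    exact sum_ne_zero_of_ne_zero
      (fun b => mul_nonneg (mul_nonneg (hf a q s) (hg b q t)) (hp a b c)) b h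
  have hPuv : ∀ s t w, P s t w ≠ 0 → u s w ≠ 0 ∧ v t w ≠ 0 := by
    intro s t w h
    obtain ⟨a, -, ha⟩ := Finset.exists_ne_zero_of_sum_ne_zero h
    obtain ⟨b, -, hb⟩ := Finset.exists_ne_zero_of_sum_ne_zero ha
    exact ⟨(huv a b w.1 s t w.2 hb).1, (huv a b w.1 s t w.2 hb).2.1⟩
  -- Summation over the outputs first.
  have swap : ∀ h : α → β → φ → ℝ,
      ∑ s, ∑ t, ∑ w : κ × φ, ∑ a, ∑ b, f a w.1 s * g b w.1 t * h a b w.2 =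
        ∑ a, ∑ b, ∑ c, h a b c := by
    intro h
    have e : ∀ a b c, h a b c = ∑ s, ∑ t, ∑ q, f a q s * g b q t * h a b c := by
      intro a b c
      simp only [← Finset.sum_mul, hfg, one_mul]
    have e' : ∑ a, ∑ b, ∑ c, h a b c =
        ∑ x : α × β × φ, ∑ y : σ × τ × κ, f x.1 y.2.2 y.1 * g x.2.1 y.2.2 y.2.1 *
          h x.1 x.2.1 x.2.2 := by
      simp only [Fintype.sum_prod_type, ← e]
    rw [e']
    refine Eq.trans ?_ Finset.sum_comm
    simp only [Fintype.sum_prod_type]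
    refine Finset.sum_congr rfl fun s _ => ?_
    refine Finset.sum_congr rfl fun t _ => ?_
    refine Finset.sum_congr rfl fun q _ => ?_
    calc _ = ∑ a, ∑ c, ∑ b, f a q s * g b q t * h a b c := Finset.sum_comm
      _ = _ := Finset.sum_congr rfl fun a _ => Finset.sum_comm
  have hPsum : ∑ s, ∑ t, ∑ w, P s t w = ∑ a, ∑ b, ∑ c, p a b c := swap p
  have huvexp : ∀ s t w, u s w * v t w =
      ∑ a, ∑ b, f a w.1 s * g b w.1 t * (S a w.2 * T b w.2 / W w.2) := by
    intro s t w
    simp only [hu, hv, Finset.sum_mul_sum]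
    refine Finset.sum_congr rfl fun a _ => Finset.sum_congr rfl fun b _ => ?_
    ring
  have huvsum : ∑ s, ∑ t, ∑ w, u s w * v t w ≤ ∑ s, ∑ t, ∑ w, P s t w := by
    rw [hPsum]
    simp only [huvexp]
    rw [swap fun a b c => S a c * T b c / W c]
    have e1 : ∑ a, ∑ b, ∑ c, S a c * T b c / W c = ∑ c, W c * W c / W c := by
      calc _ = ∑ a, ∑ c, ∑ b, S a c * T b c / W c :=
            Finset.sum_congr rfl fun a _ => Finset.sum_comm
        _ = ∑ c, ∑ a, ∑ b, S a c * T b c / W c := Finset.sum_comm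
        _ = _ := by
          refine Finset.sum_congr rfl fun c _ => ?_
          simp only [← Finset.sum_div, ← Finset.mul_sum, ← Finset.sum_mul]
          congr 2
          exact Finset.sum_comm
    have e2 : ∑ a, ∑ b, ∑ c, p a b c = ∑ c, W c := by
      calc _ = ∑ a, ∑ c, ∑ b, p a b c := Finset.sum_congr rfl fun a _ => Finset.sum_comm
        _ = _ := Finset.sum_comm
    rw [e1, e2]
    refine Finset.sum_le_sum fun c _ => ?_
    rw [mul_self_div_self]
  refine (condMutualInfo_le_relEntropy hP0 hu0 hv0 (fun s t w h => (hPuv s t w h).1)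
    (fun s t w h => (hPuv s t w h).2) huvsum).trans ?_
  -- The relative entropy with respect to the image of the reference table has decreased: apply
  -- Gibbs' inequality to the joint table `pb` of data and outputs, with the reference table `rb`
  -- reweighted such that its marginal on the outputs is at most `P`.
  set pb : (α × β) × σ × τ × κ × φ → ℝ := fun i =>
    f i.1.1 i.2.2.2.1 i.2.1 * g i.1.2 i.2.2.2.1 i.2.2.1 * p i.1.1 i.1.2 i.2.2.2.2 with hpb
  set rb : (α × β) × σ × τ × κ × φ → ℝ := fun i =>
    f i.1.1 i.2.2.2.1 i.2.1 * g i.1.2 i.2.2.2.1 i.2.2.1 *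
      (S i.1.1 i.2.2.2.2 * T i.1.2 i.2.2.2.2 / W i.2.2.2.2) *
        (P i.2.1 i.2.2.1 i.2.2.2 / (u i.2.1 i.2.2.2 * v i.2.2.1 i.2.2.2)) with hrb
  have hpb0 : ∀ i, 0 ≤ pb i := fun i => mul_nonneg (mul_nonneg (hf _ _ _) (hg _ _ _)) (hp _ _ _)
  have hrb0 : ∀ i, 0 ≤ rb i := fun i => mul_nonneg
    (mul_nonneg (mul_nonneg (hf _ _ _) (hg _ _ _))
      (div_nonneg (mul_nonneg (hS0 _ _) (hT0 _ _)) (hW0 _)))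
    (div_nonneg (hP0 _ _ _) (mul_nonneg (hu0 _ _) (hv0 _ _)))
  have hsupp : ∀ i, pb i ≠ 0 → rb i ≠ 0 := by
    intro i hi
    obtain ⟨h1, h2, h3⟩ := huv _ _ _ _ _ _ hi
    obtain ⟨h4, h5, h6⟩ := hne _ _ _ (right_ne_zero_of_mul hi)
    exact mul_ne_zero (mul_ne_zero (left_ne_zero_of_mul hi)
      (div_ne_zero (mul_ne_zero h4 h5) h6)) (div_ne_zero h3 (mul_ne_zero h1 h2))
  have hpbs : ∀ h : σ → τ → κ × φ → ℝ, ∑ i, pb i * h i.2.1 i.2.2.1 i.2.2.2 =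
      ∑ s, ∑ t, ∑ w, P s t w * h s t w := by
    intro h
    rw [Fintype.sum_prod_type_right]
    simp only [Fintype.sum_prod_type, hP, hpb, Finset.sum_mul]
  have hsum : ∑ i, rb i ≤ ∑ i, pb i := by
    have h1 := hpbs fun _ _ _ => 1
    simp only [mul_one] at h1
    rw [h1, Fintype.sum_prod_type_right]
    rw [Fintype.sum_prod_type]
    refine Finset.sum_le_sum fun s _ => ?_
    rw [Fintype.sum_prod_type]
    refine Finset.sum_le_sum fun t _ => Finset.sum_le_sum fun w _ => ?_
    simp only [hrb]
    rw [← Finset.sum_mul, Fintype.sum_prod_type]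
    simp only
    rw [← huvexp, mul_div_left_comm]
    exact mul_le_of_le_one_right (hP0 _ _ _) (div_self_le_one _)
  have key := sum_mul_logb_le_of_sum_le hpb0 hrb0 hsupp hsum
  have e1 : ∀ i, pb i * Real.logb 2 (rb i) - pb i * Real.logb 2 (pb i) =
      pb i * (Real.logb 2 (P i.2.1 i.2.2.1 i.2.2.2) - Real.logb 2 (u i.2.1 i.2.2.2) -
        Real.logb 2 (v i.2.2.1 i.2.2.2)) -
      pb i * (Real.logb 2 (p i.1.1 i.1.2 i.2.2.2.2) - Real.logb 2 (S i.1.1 i.2.2.2.2) -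
        Real.logb 2 (T i.1.2 i.2.2.2.2) + Real.logb 2 (W i.2.2.2.2)) := by
    intro i
    rcases eq_or_ne (pb i) 0 with h | h
    · simp [h]
    · obtain ⟨h1, h2, h3⟩ := huv _ _ _ _ _ _ h
      have h0 := right_ne_zero_of_mul h
      have h7 := left_ne_zero_of_mul h
      obtain ⟨h4, h5, h6⟩ := hne _ _ _ h0
      have l1 : Real.logb 2 (rb i) =
          Real.logb 2 (f i.1.1 i.2.2.2.1 i.2.1 * g i.1.2 i.2.2.2.1 i.2.2.1) +
          (Real.logb 2 (S i.1.1 i.2.2.2.2) + Real.logb 2 (T i.1.2 i.2.2.2.2) -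
            Real.logb 2 (W i.2.2.2.2)) +
          (Real.logb 2 (P i.2.1 i.2.2.1 i.2.2.2) - (Real.logb 2 (u i.2.1 i.2.2.2) +
            Real.logb 2 (v i.2.2.1 i.2.2.2))) := by
        rw [← Real.logb_mul h1 h2, ← Real.logb_mul h4 h5, ← Real.logb_div (mul_ne_zero h4 h5) h6,
          ← Real.logb_div h3 (mul_ne_zero h1 h2),
          ← Real.logb_mul h7 (div_ne_zero (mul_ne_zero h4 h5) h6),
          ← Real.logb_mul (mul_ne_zero h7 (div_ne_zero (mul_ne_zero h4 h5) h6))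
            (div_ne_zero h3 (mul_ne_zero h1 h2))]
      have l2 : Real.logb 2 (pb i) =
          Real.logb 2 (f i.1.1 i.2.2.2.1 i.2.1 * g i.1.2 i.2.2.2.1 i.2.2.1) +
          Real.logb 2 (p i.1.1 i.1.2 i.2.2.2.2) := Real.logb_mul h7 h0
      rw [l1, l2]
      ring
  have key' : ∑ i, (pb i * Real.logb 2 (rb i) - pb i * Real.logb 2 (pb i)) ≤ 0 := by
    rw [Finset.sum_sub_distrib]
    linarith
  simp only [e1, Finset.sum_sub_distrib] at key'
  rw [hpbs fun s t w => Real.logb 2 (P s t w) - Real.logb 2 (u s w) - Real.logb 2 (v t w)] at key'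
  have e3 : ∑ i, pb i * (Real.logb 2 (p i.1.1 i.1.2 i.2.2.2.2) - Real.logb 2 (S i.1.1 i.2.2.2.2) -
        Real.logb 2 (T i.1.2 i.2.2.2.2) + Real.logb 2 (W i.2.2.2.2)) = condMutualInfo p := by
    rw [condMutualInfo_eq_sum, ← swap, Fintype.sum_prod_type_right]
    simp only [Fintype.sum_prod_type, hpb, mul_assoc]
    rfl
  linarith

end Monotonicity

/-! ### Keys close to ideal ones -/

section Keys

variable {σ ω : Type*} [Fintype σ] [Fintype ω]

/-- A key which is almost uniform, given `w`, has almost maximal conditional entropy. -/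
theorem le_condEntropy_of_near_uniform [Nonempty σ] {p : σ → ω → ℝ} (hp : ∀ s w, 0 ≤ p s w)
    (h1 : ∑ s, ∑ w, p s w = 1) :
    Real.logb 2 (Fintype.card σ) - (Real.logb 2 (Fintype.card σ) + 2) *
      ∑ s, ∑ w, max (p s w - 1 / Fintype.card σ * ∑ s', p s' w) 0 ≤ condEntropy p := by
  set d : ℝ := (Fintype.card σ : ℝ) with hd
  have hd1 : (1 : ℝ) ≤ d := by
    rw [hd]
    exact_mod_cast Fintype.card_pos
  have hd0 : 0 < d := by linarith
  have hld : 0 ≤ Real.logb 2 d := Real.logb_nonneg (by norm_num) hd1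
  have key : ∀ s w, p s w * Real.logb 2 (p s w / ∑ s', p s' w) ≤
      - (p s w * Real.logb 2 d) +
        (Real.logb 2 d + 2) * max (p s w - 1 / d * ∑ s', p s' w) 0 := by
    intro s w
    set m := ∑ s', p s' w
    rcases (hp s w).eq_or_lt with h | h
    · rw [← h]
      have : (0 : ℝ) ≤ max (0 - 1 / d * m) 0 := le_max_right _ _
      simp only [zero_mul, neg_zero, zero_add]
      positivity
    have hpm : p s w ≤ m := Finset.single_le_sum (fun s' _ => hp s' w) (Finset.mem_univ s)
    have hm0 : 0 < m := by linarith
    -- The ratio of `p s w` to its ideal value `m / d`.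
    set x := d * p s w / m with hx
    have hx0 : 0 < x := by positivity
    have hxd : x ≤ d := by
      rw [hx, div_le_iff₀ hm0]
      exact mul_le_mul_of_nonneg_left hpm hd0.le
    have e : p s w / m = x / d := by
      rw [hx]
      field_simp
    have epx : p s w = 1 / d * m * x := by
      rw [hx]
      field_simp
    rw [e, Real.logb_div hx0.ne' hd0.ne', mul_sub]
    suffices p s w * Real.logb 2 x ≤ (Real.logb 2 d + 2) * max (p s w - 1 / d * m) 0 by linarith
    rcases le_total x 1 with hx1 | hx1
    · have h2 : Real.logb 2 x ≤ 0 := Real.logb_nonpos (by norm_num) hx0.le hx1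
      have h3 : p s w * Real.logb 2 x ≤ 0 := mul_nonpos_of_nonneg_of_nonpos h.le h2
      have h4 : (0 : ℝ) ≤ max (p s w - 1 / d * m) 0 := le_max_right _ _
      have : 0 ≤ (Real.logb 2 d + 2) * max (p s w - 1 / d * m) 0 := by positivity
      linarith
    · have h2 : Real.logb 2 x ≤ Real.logb 2 d := Real.logb_le_logb_of_le (by norm_num) hx0 hxd
      have h3 : Real.logb 2 x ≤ 2 * (x - 1) := by
        have h4 := Real.log_le_sub_one_of_pos hx0
        have h5 := Real.log_two_gt_d9
        rw [Real.logb, div_le_iff₀ (by linarith)]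
        nlinarith
      have h4 : 0 ≤ 1 / d * m := by positivity
      have h5 : p s w - 1 / d * m = 1 / d * m * (x - 1) := by rw [epx]; ring
      have h6 : 0 ≤ p s w - 1 / d * m := by
        rw [h5]
        exact mul_nonneg h4 (by linarith)
      rw [max_eq_left h6]
      calc p s w * Real.logb 2 x
          = (p s w - 1 / d * m) * Real.logb 2 x + 1 / d * m * Real.logb 2 x := by ring
        _ ≤ (p s w - 1 / d * m) * Real.logb 2 d + 1 / d * m * (2 * (x - 1)) :=
          add_le_add (mul_le_mul_of_nonneg_left h2 h6) (mul_le_mul_of_nonneg_left h3 h4)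
        _ = _ := by rw [h5]; ring
  have h := Finset.sum_le_sum fun s (_ : s ∈ Finset.univ) =>
    Finset.sum_le_sum fun w (_ : w ∈ Finset.univ) => key s w
  simp only [Finset.sum_add_distrib, Finset.sum_neg_distrib, ← Finset.sum_mul, ← Finset.mul_sum,
    h1] at h
  rw [condEntropy_eq_sum hp]
  linarith

open Classical in
/-- Fano's inequality, with the crude bound `1` for the binary entropy. -/
theorem condEntropy_le_of_near_equal [Nonempty σ] {p : σ → σ × ω → ℝ} (hp : ∀ s w, 0 ≤ p s w)
    (h1 : ∑ s, ∑ w, p s w = 1) :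
    condEntropy p ≤ 1 + Real.logb 2 (Fintype.card σ) *
      ∑ s, ∑ w : σ × ω, if s = w.1 then 0 else p s w := by
  set d : ℝ := (Fintype.card σ : ℝ) with hd
  have hd1 : (1 : ℝ) ≤ d := by
    rw [hd]
    exact_mod_cast Fintype.card_pos
  have hd0 : 0 < d := by linarith
  -- Guess that `s` is the first component of `w` with probability `1 / 2`, and uniform otherwise.
  refine (condEntropy_le hp (r := fun s w => (if s = w.1 then 1 / 2 else 0) + 1 / (2 * d))
    (fun s w => ?_) (fun s w _ => ?_) (fun w => ?_)).trans ?_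
  · split_ifs <;> positivity
  · refine ne_of_gt ?_
    split_ifs <;> positivity
  · rw [Finset.sum_add_distrib]
    simp only [Finset.sum_ite_eq', Finset.mem_univ, if_true, Finset.sum_const, Finset.card_univ,
      nsmul_eq_mul, ← hd]
    apply le_of_eq
    field_simp
    norm_num
  · have key : ∀ s (w : σ × ω),
        -(p s w * Real.logb 2 ((if s = w.1 then 1 / 2 else 0) + 1 / (2 * d))) ≤
        p s w + Real.logb 2 d * if s = w.1 then 0 else p s w := by
      intro s w
      split_ifs with h
      · have h2 : (-1 : ℝ) ≤ Real.logb 2 (1 / 2 + 1 / (2 * d)) := by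
          rw [Real.le_logb_iff_rpow_le (by norm_num) (by positivity), Real.rpow_neg_one]
          have : 0 ≤ 1 / (2 * d) := by positivity
          linarith
        nlinarith [hp s w]
      · rw [zero_add, one_div, Real.logb_inv, Real.logb_mul (by norm_num) hd0.ne',
          Real.logb_self_eq_one (by norm_num)]
        apply le_of_eq
        ring
    have h := Finset.sum_le_sum fun s (_ : s ∈ Finset.univ) =>
      Finset.sum_le_sum fun w (_ : w ∈ Finset.univ) => key s w
    simp only [Finset.sum_add_distrib, Finset.sum_neg_distrib, ← Finset.mul_sum, h1] at h
    exact h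

end Keys

/-! ### The one-shot converse bound -/

section OneShot

variable {α β γ υ φ σ κ : Type*} [Fintype α] [Fintype β] [Fintype γ] [Fintype υ] [Fintype φ]
  [Fintype σ] [Fintype κ]

open Classical in
/-- The one-shot form of the converse. The honest parties turn `a` and `b` into keys and public
communication with probabilities `f a q s * g b q t`; the adversary holds `e`. If the keys are
`ε`-close to ideal ones, then their length is bounded, up to errors, by `I(A:B|F) + H(U)` for every
channel `θ` from `ABE` to `U` and every channel `Φ` from `EU` to `F`: passing from `E` to `EU`
costs at most `H(U)` of the entropy of the key, and passing from `EU` to `F` costs nothing. -/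
theorem logb_card_key_le [Nonempty σ] {p : α → β → γ → ℝ} (hp : ∀ a b e, 0 ≤ p a b e)
    (hp1 : ∑ a, ∑ b, ∑ e, p a b e = 1)
    {θ : α → β → γ → υ → ℝ} (hθ : ∀ a b e u, 0 ≤ θ a b e u) (hθ1 : ∀ a b e, ∑ u, θ a b e u = 1)
    {Φ : γ × υ → φ → ℝ} (hΦ : ∀ x c, 0 ≤ Φ x c) (hΦ1 : ∀ x, ∑ c, Φ x c = 1)
    {f : α → κ → σ → ℝ} {g : β → κ → σ → ℝ} (hf : ∀ a q s, 0 ≤ f a q s)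
    (hg : ∀ b q t, 0 ≤ g b q t) (hfg : ∀ a b, ∑ s, ∑ t, ∑ q, f a q s * g b q t = 1)
    {R : σ → σ → κ → γ → ℝ}
    (hR : ∀ s t q e, R s t q e = ∑ a, ∑ b, f a q s * g b q t * p a b e) {ε : ℝ}
    (hε : ∑ s, ∑ t, ∑ q, ∑ e, max (R s t q e -
      (if s = t then 1 / (Fintype.card σ : ℝ) else 0) * ∑ s', ∑ t', R s' t' q e) 0 ≤ ε) :
    Real.logb 2 (Fintype.card σ) ≤
      condMutualInfo (fun a b c => ∑ x : γ × υ, Φ x c * (θ a b x.1 x.2 * p a b x.1)) +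
      entropy (fun u => ∑ a, ∑ b, ∑ e, θ a b e u * p a b e) +
      (1 + 2 * ε + 2 * ε * Real.logb 2 (Fintype.card σ)) := by
  set ν : α × β × γ × υ × σ × σ × κ → ℝ := fun ⟨a, b, e, u, s, t, q⟩ =>
    f a q s * g b q t * (θ a b e u * p a b e) with hν
  have hν0 : ∀ i, 0 ≤ ν i := fun i =>
    mul_nonneg (mul_nonneg (hf _ _ _) (hg _ _ _)) (mul_nonneg (hθ _ _ _ _) (hp _ _ _))
  set μ : (α × β × γ × υ × σ × σ × κ) × φ → ℝ := fun i =>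
    ν i.1 * Φ (i.1.2.2.1, i.1.2.2.2.1) i.2 with hμ
  have hμ0 : ∀ i, 0 ≤ μ i := fun i => mul_nonneg (hν0 _) (hΦ _ _)
  let rA : (α × β × γ × υ × σ × σ × κ) × φ → α := fun i => i.1.1
  let rB : (α × β × γ × υ × σ × σ × κ) × φ → β := fun i => i.1.2.1
  let rE : (α × β × γ × υ × σ × σ × κ) × φ → γ := fun i => i.1.2.2.1
  let rU : (α × β × γ × υ × σ × σ × κ) × φ → υ := fun i => i.1.2.2.2.1
  let rS : (α × β × γ × υ × σ × σ × κ) × φ → σ := fun i => i.1.2.2.2.2.1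
  let rT : (α × β × γ × υ × σ × σ × κ) × φ → σ := fun i => i.1.2.2.2.2.2.1
  let rQ : (α × β × γ × υ × σ × σ × κ) × φ → κ := fun i => i.1.2.2.2.2.2.2
  let rF : (α × β × γ × υ × σ × σ × κ) × φ → φ := fun i => i.2
  have hfg' : ∀ a b c, ∑ s, ∑ t, ∑ q, f a q s * g b q t * c = c := by
    intro a b c
    simp only [← Finset.sum_mul, hfg, one_mul]
  have hΦ' : ∀ x c, ∑ y, c * Φ x y = c := by
    intro x c
    rw [← Finset.mul_sum, hΦ1, mul_one]
  have hθ' : ∀ a b e c, ∑ u, θ a b e u * c = c := by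
    intro a b e c
    rw [← Finset.sum_mul, hθ1, one_mul]
  have hμ1 : ∑ i, μ i = 1 := by
    simp only [hμ, Fintype.sum_prod_type, hν, hΦ', hfg', hθ', hp1]
  -- The joint distributions needed below.
  have lABF : ∀ a b c, law μ (fun i => (rA i, rB i, rF i)) (a, b, c) =
      ∑ x : γ × υ, Φ x c * (θ a b x.1 x.2 * p a b x.1) := by
    intro a b c
    simp only [law, Fintype.sum_prod_type, hμ, hν, rA, rB, rF, Prod.mk.injEq, ite_and,
      Finset.sum_ite_irrel, Finset.sum_const_zero, Finset.sum_ite_eq', Finset.mem_univ, if_true,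
      mul_assoc]
    simp only [← mul_assoc (f _ _ _), hfg']
    refine Finset.sum_congr rfl fun e _ => Finset.sum_congr rfl fun u _ => ?_
    ring
  have lU : ∀ u, law μ rU u = ∑ a, ∑ b, ∑ e, θ a b e u * p a b e := by
    intro u
    simp only [law, Fintype.sum_prod_type, hμ, hν, rU,
      Finset.sum_ite_irrel, Finset.sum_const_zero, Finset.sum_ite_eq', Finset.mem_univ, if_true,
      hΦ', hfg']
  have lSTQE : ∀ s t q e, law μ (fun i => (rS i, rT i, (rQ i, rE i))) (s, t, (q, e)) =
      R s t q e := by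
    intro s t q e
    simp only [law, Fintype.sum_prod_type, hμ, hν, rS, rT, rQ, rE, Prod.mk.injEq, ite_and,
      Finset.sum_ite_irrel, Finset.sum_const_zero, Finset.sum_ite_eq', Finset.mem_univ, if_true,
      hΦ', ← Finset.mul_sum, hθ', hR]
  have lSTQF : ∀ s t (w : κ × φ), law μ (fun i => (rS i, rT i, (rQ i, rF i))) (s, t, w) =
      ∑ a, ∑ b, f a w.1 s * g b w.1 t *
        ∑ x : γ × υ, Φ x w.2 * (θ a b x.1 x.2 * p a b x.1) := by
    rintro s t ⟨q, c⟩
    simp only [law, Fintype.sum_prod_type, hμ, hν, rS, rT, rQ, rF, Prod.mk.injEq, ite_and,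
      Finset.sum_ite_irrel, Finset.sum_const_zero, Finset.sum_ite_eq', Finset.mem_univ, if_true,
      Finset.mul_sum]
    refine Finset.sum_congr rfl fun a _ => Finset.sum_congr rfl fun b _ =>
      Finset.sum_congr rfl fun e _ => Finset.sum_congr rfl fun u _ => ?_
    ring
  have hd1 : (1 : ℝ) ≤ Fintype.card σ := by exact_mod_cast Fintype.card_pos
  have hld : 0 ≤ Real.logb 2 (Fintype.card σ) := Real.logb_nonneg (by norm_num) hd1
  -- The key is almost uniform given `q` and `e`.
  have k1 := le_condEntropy_of_near_uniform
    (p := fun s w => law μ (fun i => (rS i, (rQ i, rE i))) (s, w))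
    (fun s w => law_nonneg hμ0 _ _) (by
      rw [← hμ1, ← sum_law fun i => (rS i, (rQ i, rE i)), Fintype.sum_prod_type])
  have k1' : ∑ s, ∑ w : κ × γ, max (law μ (fun i => (rS i, (rQ i, rE i))) (s, w) -
      1 / Fintype.card σ * ∑ s', law μ (fun i => (rS i, (rQ i, rE i))) (s', w)) 0 ≤ ε := by
    refine le_trans (Finset.sum_le_sum fun s _ => ?_) hε
    have e1 : ∑ t, ∑ q, ∑ e, max (R s t q e -
        (if s = t then 1 / (Fintype.card σ : ℝ) else 0) * ∑ s', ∑ t', R s' t' q e) 0 =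
        ∑ w : κ × γ, ∑ t, max (R s t w.1 w.2 -
        (if s = t then 1 / (Fintype.card σ : ℝ) else 0) * ∑ s', ∑ t', R s' t' w.1 w.2) 0 := by
      simp only [Fintype.sum_prod_type]
      exact Finset.sum_comm.trans (Finset.sum_congr rfl fun q _ => Finset.sum_comm)
    rw [e1]
    refine Finset.sum_le_sum fun w _ => max_le ?_ (Finset.sum_nonneg fun t _ => le_max_right _ _)
    refine le_trans (le_of_eq ?_) (Finset.sum_le_sum fun t _ => le_max_left _ _)
    rw [Finset.sum_sub_distrib, ← Finset.sum_mul]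
    simp only [← sum_law_triple_middle rS rT fun i => (rQ i, rE i), lSTQE, Finset.sum_ite_eq,
      Finset.mem_univ, if_true]
  -- The keys are almost always equal.
  have k2 := condEntropy_le_of_near_equal
    (p := fun s w => law μ (fun i => (rS i, (rT i, (rQ i, rF i)))) (s, w))
    (fun s w => law_nonneg hμ0 _ _) (by
      rw [← hμ1, ← sum_law fun i => (rS i, (rT i, (rQ i, rF i))), Fintype.sum_prod_type])
  have k2' : ∑ s, ∑ w : σ × κ × φ, (if s = w.1 then 0 else
      law μ (fun i => (rS i, (rT i, (rQ i, rF i)))) (s, w)) ≤ ε := by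
    refine le_trans ?_ hε
    simp only [Fintype.sum_prod_type]
    refine Finset.sum_le_sum fun s _ => Finset.sum_le_sum fun t _ => Finset.sum_le_sum fun q _ => ?_
    split_ifs with h
    · simpa using Finset.sum_nonneg fun e _ => le_max_right _ _
    · have e1 : ∑ c, law μ (fun i => (rS i, (rT i, (rQ i, rF i)))) (s, (t, (q, c))) =
          ∑ e, R s t q e := by
        have e2 := sum_law_pair_right (μ := μ) (fun i => (rS i, rT i, rQ i)) rF (s, t, q)
        rw [← sum_law_pair_right (μ := μ) (fun i => (rS i, rT i, rQ i)) rE (s, t, q)] at e2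
        simpa only [law, Prod.mk.injEq, and_assoc, ← lSTQE] using e2
      rw [e1]
      exact Finset.sum_le_sum fun e _ => by simp
  -- Monotonicity gives `I(S:T|QF) ≤ I(A:B|F)`.
  have k3 := condMutualInfo_local_le
    (p := fun a b c => ∑ x : γ × υ, Φ x c * (θ a b x.1 x.2 * p a b x.1))
    (fun a b c => Finset.sum_nonneg fun x _ =>
      mul_nonneg (hΦ _ _) (mul_nonneg (hθ _ _ _ _) (hp _ _ _))) hf hg hfg
  simp only [← lSTQF] at k3
  rw [condMutualInfo_law rS rT fun i => (rQ i, rF i)] at k3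
  -- `H(S|QF) ≥ H(S|QEUF) = H(S|QEU)`, the last step as `F` is drawn from a channel on `EU`.
  have k4 := rvEntropy_submodular hμ0 rS (fun i => (rE i, rU i)) fun i => (rQ i, rF i)
  have k5 := rvEntropy_channel hν0 (fun x c => Φ x c) hΦ hΦ1
    (fun j : α × β × γ × υ × σ × σ × κ => (j.2.2.2.2.1, j.2.2.2.2.2.2, j.2.2.1, j.2.2.2.1))
    (fun w => (w.2.2.1, w.2.2.2))
  have k6 := rvEntropy_channel hν0 (fun x c => Φ x c) hΦ hΦ1
    (fun j : α × β × γ × υ × σ × σ × κ => (j.2.2.2.2.2.2, j.2.2.1, j.2.2.2.1))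
    (fun w => (w.2.1, w.2.2))
  -- `H(S|QEU) ≥ H(S|QE) - H(U)`.
  have k7 : rvEntropy μ (fun i => (rS i, (rQ i, rE i))) ≤
      rvEntropy μ fun i => (rS i, rQ i, rE i, rU i) :=
    rvEntropy_le_of_determined hμ0 (by simp +contextual)
  have k8 := rvEntropy_pair_le hμ0 hμ1 (fun i => (rQ i, rE i)) rU
  have k9 : rvEntropy μ (fun i => ((rQ i, rE i), rU i)) =
      rvEntropy μ fun i => (rQ i, rE i, rU i) := rvEntropy_congr hμ0 (by simp [and_assoc])
  have k10 : rvEntropy μ (fun i => ((rS i, rQ i, rE i, rU i), rF i)) =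
      rvEntropy μ fun i => (rS i, (rE i, rU i), (rQ i, rF i)) :=
    rvEntropy_congr hμ0 (by simp; tauto)
  have k11 : rvEntropy μ (fun i => ((rQ i, rE i, rU i), rF i)) =
      rvEntropy μ fun i => ((rE i, rU i), (rQ i, rF i)) :=
    rvEntropy_congr hμ0 (by simp; tauto)
  have k12 : entropy (fun u => ∑ a, ∑ b, ∑ e, θ a b e u * p a b e) = rvEntropy μ rU := by
    rw [rvEntropy]
    exact congrArg entropy (funext fun u => (lU u).symm)
  change rvEntropy μ (fun i => ((rS i, rQ i, rE i, rU i), rF i)) =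
    rvEntropy μ (fun i => (rS i, rQ i, rE i, rU i)) - _ at k5
  change rvEntropy μ (fun i => ((rQ i, rE i, rU i), rF i)) =
    rvEntropy μ (fun i => (rQ i, rE i, rU i)) - _ at k6
  rw [condEntropy_law] at k1 k2
  simp only [← lABF] at k3 ⊢
  have k13 := mul_le_mul_of_nonneg_left k1' (by linarith :
    0 ≤ Real.logb 2 (Fintype.card σ) + 2)
  have k14 := mul_le_mul_of_nonneg_left k2' hld
  rw [k12]
  linarith

end OneShot

/-! ### Factorization of local operations and public communication -/

section Transcript

/-- Sequentially drawn messages have total probability one. -/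
theorem sum_prod_sequential {m : ℕ} (n : ℕ)
    (κ : (t : Fin n) → (Fin t → Fin m) → stdSimplex ℝ (Fin m)) :
    ∑ q : Fin n → Fin m, ∏ t : Fin n, (κ t fun s => q (s.castLE t.isLt.le)).1 (q t) = 1 := by
  induction n with
  | zero => simp
  | succ n ih =>
    rw [← (Fin.snocEquiv fun _ : Fin (n + 1) => Fin m).sum_comp, Fintype.sum_prod_type_right,
      ← ih fun t => κ t.castSucc]
    refine Finset.sum_congr rfl fun q _ => ?_
    have e : ∀ x : Fin m, (∏ t : Fin (n + 1), (κ t fun s =>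
        (Fin.snoc q x : Fin (n + 1) → Fin m) (s.castLE t.isLt.le)).1
          ((Fin.snoc q x : Fin (n + 1) → Fin m) t)) =
        (∏ t : Fin n, (κ t.castSucc fun s => q (s.castLE t.isLt.le)).1 (q t)) *
          (κ (Fin.last n) q).1 x := by
      intro x
      have e1 : ∀ t : Fin n, (fun s : Fin t =>
          (Fin.snoc q x : Fin (n + 1) → Fin m) (s.castLE t.castSucc.isLt.le)) =
            fun s => q (s.castLE t.isLt.le) := fun t => funext fun s =>
        Fin.snoc_castSucc (α := fun _ => Fin m) x q (s.castLE t.isLt.le)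
      have e2 : (fun s : Fin n =>
          (Fin.snoc q x : Fin (n + 1) → Fin m) (s.castLE (Fin.last n).isLt.le)) = q :=
        funext fun s => Fin.snoc_castSucc (α := fun _ => Fin m) x q s
      rw [Fin.prod_univ_castSucc, Fin.snoc_last]
      congr 1
      · refine Finset.prod_congr rfl fun t _ => ?_
        rw [Fin.snoc_castSucc]
        exact congrArg (fun h => (κ t.castSucc h).1 (q t)) (e1 t)
      · exact congrArg (fun h => (κ (Fin.last n) h).1 x) e2
    refine (Finset.sum_congr rfl fun x _ => e x).trans ?_
    rw [← Finset.mul_sum, (κ (Fin.last n) q).2.2, mul_one]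
    rfl

variable {α β : Type*} (L : LOPC α β)

/-- Alice's factor of the probability of a transcript: her messages are those of the even rounds. -/
def LOPC.factorA (a : α) (q : L.Transcript) : ℝ :=
  ∏ t : Fin L.rounds, if Even (t : ℕ) then (L.msgA t a fun s => q (s.castLE t.isLt.le)).1 (q t)
    else 1

/-- Bob's factor of the probability of a transcript: his messages are those of the odd rounds. -/
def LOPC.factorB (b : β) (q : L.Transcript) : ℝ :=
  ∏ t : Fin L.rounds, if Even (t : ℕ) then 1
    else (L.msgB t b fun s => q (s.castLE t.isLt.le)).1 (q t)

theorem LOPC.factorA_nonneg (a : α) (q : L.Transcript) : 0 ≤ L.factorA a q :=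
  Finset.prod_nonneg fun t _ => by
    split_ifs
    · exact (L.msgA t a _).2.1 _
    · exact zero_le_one

theorem LOPC.factorB_nonneg (b : β) (q : L.Transcript) : 0 ≤ L.factorB b q :=
  Finset.prod_nonneg fun t _ => by
    split_ifs
    · exact zero_le_one
    · exact (L.msgB t b _).2.1 _

theorem LOPC.transcriptProb_eq (a : α) (b : β) (q : L.Transcript) :
    L.transcriptProb a b q = L.factorA a q * L.factorB b q := by
  rw [transcriptProb, factorA, factorB, ← Finset.prod_mul_distrib]
  refine Finset.prod_congr rfl fun t _ => ?_
  split_ifs <;> simp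

theorem LOPC.sum_transcriptProb (a : α) (b : β) : ∑ q, L.transcriptProb a b q = 1 := by
  rw [← sum_prod_sequential L.rounds fun t h => if Even (t : ℕ) then L.msgA t a h else L.msgB t b h]
  refine Finset.sum_congr rfl fun q _ => Finset.prod_congr rfl fun t _ => ?_
  split_ifs <;> rfl

theorem LOPC.outProb_eq (a : α) (b : β) (s t : Fin L.keyCard) (q : L.Transcript) :
    L.outProb a b s t q =
      L.factorA a q * (L.keyA a q).1 s * (L.factorB b q * (L.keyB b q).1 t) := by
  rw [outProb, transcriptProb_eq]
  ring

theorem LOPC.sum_outProb (a : α) (b : β) :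
    ∑ s, ∑ t, ∑ q, L.factorA a q * (L.keyA a q).1 s * (L.factorB b q * (L.keyB b q).1 t) = 1 := by
  rw [← L.sum_transcriptProb a b]
  calc _ = ∑ s, ∑ q, ∑ t, L.factorA a q * (L.keyA a q).1 s * (L.factorB b q * (L.keyB b q).1 t) :=
        Finset.sum_congr rfl fun s _ => Finset.sum_comm
    _ = ∑ q, ∑ s, ∑ t, L.factorA a q * (L.keyA a q).1 s * (L.factorB b q * (L.keyB b q).1 t) :=
        Finset.sum_comm
    _ = _ := by
        refine Finset.sum_congr rfl fun q _ => ?_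
        simp only [← Finset.mul_sum, ← Finset.sum_mul, (L.keyA a q).2.2, (L.keyB b q).2.2,
          mul_one, transcriptProb_eq]

theorem LOPC.keyCard_pos [Nonempty α] [Nonempty β] : 0 < L.keyCard := by
  obtain ⟨a⟩ := ‹Nonempty α›
  obtain ⟨b⟩ := ‹Nonempty β›
  refine Nat.pos_of_ne_zero fun h => ?_
  have h1 := L.sum_outProb a b
  have : IsEmpty (Fin L.keyCard) := by rw [h]; infer_instance
  simp at h1

end Transcript

/-! ### Additivity for independent copies -/

section Copies

variable {α β γ : Type*} [Fintype α] [Fintype β] [Fintype γ]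

theorem sum_prod_fun {N : ℕ} (f : Fin N → α → ℝ) :
    ∑ a : Fin N → α, ∏ n, f n (a n) = ∏ n, ∑ a, f n a := by
  classical
  rw [Finset.prod_univ_sum, Fintype.piFinset_univ]

theorem sum_prod_fun_fun_fun {N : ℕ} (f : Fin N → α → β → γ → ℝ) :
    ∑ a : Fin N → α, ∑ b : Fin N → β, ∑ c : Fin N → γ, ∏ n, f n (a n) (b n) (c n) =
      ∏ n, ∑ a, ∑ b, ∑ c, f n a b c := by
  rw [← sum_prod_fun fun n a => ∑ b, ∑ c, f n a b c]
  refine Finset.sum_congr rfl fun a _ => ?_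
  rw [← sum_prod_fun fun n b => ∑ c, f n (a n) b c]
  exact Finset.sum_congr rfl fun b _ => sum_prod_fun fun n c => f n (a n) (b n) c

theorem entropy_pow {p : α → ℝ} (h1 : ∑ a, p a = 1) (N : ℕ) :
    entropy (fun a : Fin N → α => ∏ n, p (a n)) = N * entropy p := by
  induction N with
  | zero => simp [entropy]
  | succ N ih =>
    have h2 : ∑ a : Fin N → α, ∏ n, p (a n) = 1 := by
      rw [sum_prod_fun fun _ => p, h1, Finset.prod_const_one]
    rw [← entropy_comp_equiv (Fin.consEquiv fun _ : Fin (N + 1) => α)]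
    have e : ∀ (x : α) (a : Fin N → α), p x * (∏ n, p (a n)) *
        Real.logb 2 (p x * ∏ n, p (a n)) =
        p x * Real.logb 2 (p x) * (∏ n, p (a n)) +
          p x * ((∏ n, p (a n)) * Real.logb 2 (∏ n, p (a n))) := by
      intro x a
      rcases eq_or_ne (p x) 0 with h | h
      · simp [h]
      rcases eq_or_ne (∏ n, p (a n)) 0 with h' | h'
      · simp [h']
      rw [Real.logb_mul h h']
      ring
    simp only [entropy, Fin.consEquiv, Equiv.coe_fn_mk, Fin.prod_univ_succ, Fin.cons_zero,
      Fin.cons_succ, Fintype.sum_prod_type, e, Finset.sum_add_distrib, ← Finset.mul_sum, h2,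
      ← Finset.sum_mul, h1] at ih ⊢
    push_cast
    linarith

theorem entropy_pow_prod {p : α × γ → ℝ} (h1 : ∑ t, p t = 1) (N : ℕ) :
    entropy (fun t : (Fin N → α) × (Fin N → γ) => ∏ n, p (t.1 n, t.2 n)) = N * entropy p := by
  rw [← entropy_pow h1, ← entropy_comp_equiv (Equiv.arrowProdEquivProdArrow (Fin N)
    (fun _ => α) (fun _ => γ))]
  rfl

theorem condEntropy_pow {p : α → γ → ℝ} (h1 : ∑ a, ∑ c, p a c = 1) (N : ℕ) :
    condEntropy (fun (a : Fin N → α) (c : Fin N → γ) => ∏ n, p (a n) (c n)) =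
      N * condEntropy p := by
  classical
  have h2 : ∑ c, ∑ a, p a c = 1 := by rw [Finset.sum_comm, h1]
  have e : ∀ c : Fin N → γ, ∑ a : Fin N → α, ∏ n, p (a n) (c n) = ∏ n, ∑ a, p a (c n) :=
    fun c => sum_prod_fun fun n a => p a (c n)
  simp only [condEntropy, e]
  rw [entropy_pow h2, entropy_pow_prod (p := fun t => p t.1 t.2)
    (by rwa [Fintype.sum_prod_type]), mul_sub]

theorem condMutualInfo_pow {p : α → β → γ → ℝ} (h1 : ∑ a, ∑ b, ∑ c, p a b c = 1) (N : ℕ) :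
    condMutualInfo (fun (a : Fin N → α) (b : Fin N → β) (c : Fin N → γ) =>
      ∏ n, p (a n) (b n) (c n)) = N * condMutualInfo p := by
  classical
  have eB : ∀ (a : Fin N → α) (c : Fin N → γ), ∑ b : Fin N → β, ∏ n, p (a n) (b n) (c n) =
      ∏ n, ∑ b, p (a n) b (c n) :=
    fun a c => sum_prod_fun fun n b => p (a n) b (c n)
  have eA : ∀ (b : Fin N → β) (c : Fin N → γ), ∑ a : Fin N → α, ∏ n, p (a n) (b n) (c n) =
      ∏ n, ∑ a, p a (b n) (c n) :=
    fun b c => sum_prod_fun fun n a => p a (b n) (c n)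
  have h2 : ∑ a, ∑ c, ∑ b, p a b c = 1 := by
    rw [← h1]
    exact Finset.sum_congr rfl fun a _ => Finset.sum_comm
  have h3 : ∑ b, ∑ c, ∑ a, p a b c = 1 := by
    rw [← h1]
    exact (Finset.sum_congr rfl fun b _ => Finset.sum_comm).trans Finset.sum_comm
  have h4 : condEntropy (fun (t : (Fin N → α) × (Fin N → β)) (c : Fin N → γ) =>
      ∏ n, p (t.1 n) (t.2 n) (c n)) = N * condEntropy fun (t : α × β) c => p t.1 t.2 c := by
    rw [← condEntropy_pow (p := fun (t : α × β) c => p t.1 t.2 c)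
      (by rwa [Fintype.sum_prod_type])]
    have e := (Equiv.arrowProdEquivProdArrow (Fin N) (fun _ => α) (fun _ => β))
    simp only [condEntropy]
    congr 1
    · rw [← entropy_comp_equiv ((Equiv.arrowProdEquivProdArrow (Fin N) (fun _ => α)
        (fun _ => β)).prodCongr (Equiv.refl (Fin N → γ)))]
      rfl
    · congr 1
      funext c
      rw [← (Equiv.arrowProdEquivProdArrow (Fin N) (fun _ => α) (fun _ => β)).sum_comp]
      rfl
  simp only [condMutualInfo, eA, eB]
  rw [condEntropy_pow h2, condEntropy_pow h3, h4]
  ring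

end Copies

/-! ### Ensembles of pure devices -/

section Ensembles

theorem exists_weights_of_mem_convexHull_range {Z E : Type*} [Fintype Z] [AddCommGroup E]
    [Module ℝ E] {v : Z → E} {x : E} (hx : x ∈ convexHull ℝ (Set.range v)) :
    ∃ l : stdSimplex ℝ Z, ∑ z, l.1 z • v z = x := by
  classical
  have h : convexHull ℝ (Set.range v) ⊆
      Fintype.linearCombination ℝ v '' (stdSimplex ℝ Z) := by
    refine convexHull_min ?_ ((convex_stdSimplex ℝ Z).linear_image _)
    rintro _ ⟨z, rfl⟩
    exact ⟨Pi.single z 1, single_mem_stdSimplex ℝ z, by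
      simp [Fintype.linearCombination_apply_single]⟩
  obtain ⟨l, hl, rfl⟩ := h hx
  exact ⟨⟨l, hl⟩, rfl⟩

variable {ι : Type*} {X A : ι → Type*} [Fintype ι] [DecidableEq ι] [∀ i, Fintype (X i)]
  [∀ i, Fintype (A i)]

theorem convex_nsPolytope {ι : Type*} {X A : ι → Type*} [Fintype ι] [DecidableEq ι]
    [∀ i, Fintype (A i)] : Convex ℝ (nsPolytope X A) := by
  intro P hP Q hQ s t hs ht hst
  refine ⟨fun x a => ?_, fun x => ?_, fun S x x' hx a => ?_⟩
  · exact add_nonneg (mul_nonneg hs (hP.1 x a)) (mul_nonneg ht (hQ.1 x a))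
  · simp [Finset.sum_add_distrib, ← Finset.mul_sum, hP.2.1, hQ.2.1, hst]
  · have e : ∀ y : ∀ i, X i, ∀ T : (∀ i, A i) → Prop, ∀ _ : DecidablePred T,
        (∑ a', if T a' then (s • P + t • Q) y a' else 0) =
          s * (∑ a', if T a' then P y a' else 0) + t * ∑ a', if T a' then Q y a' else 0 := by
      intro y T _
      rw [Finset.mul_sum, Finset.mul_sum, ← Finset.sum_add_distrib]
      refine Finset.sum_congr rfl fun a' _ => ?_
      split_ifs <;> simp
    rw [e, e, hP.2.2 S x x' hx a, hQ.2.2 S x x' hx a]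

theorem isCompact_nsPolytope : IsCompact (nsPolytope X A) := by
  have hK : IsCompact (Set.univ.pi fun _ : ∀ i, X i => Set.univ.pi fun _ : ∀ i, A i =>
      Set.Icc (0 : ℝ) 1) :=
    isCompact_univ_pi fun _ => isCompact_univ_pi fun _ => isCompact_Icc
  refine hK.of_isClosed_subset ?_ ?_
  · refine IsSeqClosed.isClosed fun u P hu hlim => ?_
    have c : ∀ x a, Filter.Tendsto (fun n => u n x a) Filter.atTop (nhds (P x a)) := fun x a =>
      tendsto_pi_nhds.1 (tendsto_pi_nhds.1 hlim x) a
    have c' : ∀ x, ∀ T : (∀ i, A i) → Prop, ∀ _ : DecidablePred T,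
        Filter.Tendsto (fun n => ∑ a', if T a' then u n x a' else 0) Filter.atTop
          (nhds (∑ a', if T a' then P x a' else 0)) := by
      intro x T _
      refine tendsto_finsetSum _ fun a _ => ?_
      split_ifs
      · exact c x a
      · exact tendsto_const_nhds
    refine ⟨fun x a => ge_of_tendsto' (c x a) fun n => (hu n).1 x a, fun x => ?_,
      fun S x x' hx a => ?_⟩
    · refine tendsto_nhds_unique (tendsto_finsetSum _ fun a _ => c x a) ?_
      simp only [(hu _).2.1, tendsto_const_nhds]
    · exact tendsto_nhds_unique (c' x _ _)
        ((c' x' _ _).congr fun n => ((hu n).2.2 S x x' hx a).symm)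
  · intro P hP x _ a _
    refine ⟨hP.1 x a, ?_⟩
    rw [← hP.2.1 x]
    exact Finset.single_le_sum (fun a _ => hP.1 x a) (Finset.mem_univ a)

/-- Every non-signaling device is an average of pure devices, by the Krein-Milman theorem. -/
theorem exists_isPureEnsemble {P : Box X A} (hP : P ∈ nsPolytope X A) :
    ∃ w, IsPureEnsemble P w := by
  have h : P ∈ convexHull ℝ (Set.range fun V : PureDevice X A => V.1) := by
    have h1 := closure_convexHull_extremePoints (isCompact_nsPolytope (X := X) (A := A))
      convex_nsPolytope
    have h2 : ((nsPolytope X A).extremePoints ℝ).Finite := Set.toFinite _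
    rw [(h2.isClosed_convexHull ℝ).closure_eq] at h1
    rw [Subtype.range_val, h1]
    exact hP
  obtain ⟨l, hl⟩ := exists_weights_of_mem_convexHull_range h
  refine ⟨l.1, l.2.1, l.2.2, fun x a => ?_⟩
  rw [← hl]
  simp [Finset.sum_apply]

/-- Every pure-members ensemble is a mixture of minimal ones: a smaller ensemble can be split off
until nothing remains. -/
theorem IsPureEnsemble.exists_mixture {P : Box X A} {w : PureDevice X A → ℝ}
    (hw : IsPureEnsemble P w) :
    ∃ l : stdSimplex ℝ (MinimalEnsemble P), ∀ V, ∑ z, l.1 z * z.1 V = w V := by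
  suffices h : ∀ (n : ℕ) (w : PureDevice X A → ℝ), IsPureEnsemble P w →
      (Function.support w).ncard = n →
      w ∈ convexHull ℝ (Set.range fun z : MinimalEnsemble P => z.1) by
    obtain ⟨l, hl⟩ := exists_weights_of_mem_convexHull_range (h _ w hw rfl)
    exact ⟨l, fun V => by rw [← hl]; simp [Finset.sum_apply]⟩
  intro n
  induction n using Nat.strong_induction_on with
  | _ n ih =>
    intro w hw hn
    by_cases hmin : ∀ w', IsPureEnsemble P w' → ¬ Function.support w' ⊂ Function.support w
    · exact subset_convexHull ℝ _ ⟨⟨w, hw, hmin⟩, rfl⟩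
    push Not at hmin
    obtain ⟨w', hw', hss⟩ := hmin
    have hw'mem := ih _ (hn ▸ Set.ncard_lt_ncard hss (Set.toFinite _)) w' hw' rfl
    have hex : ∃ V, 0 < w' V := by
      by_contra! h
      have := Finset.sum_nonpos fun V (_ : V ∈ Finset.univ) => h V
      rw [hw'.2.1] at this
      linarith
    obtain ⟨V₁, hV₁⟩ := hex
    -- `t` is the largest multiple of `w'` below `w`.
    obtain ⟨V₀, hV₀, hle⟩ := Finset.exists_min_image
      (Finset.univ.filter fun V => 0 < w' V) (fun V => w V / w' V) ⟨V₁, by simpa using hV₁⟩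
    have hV₀' : 0 < w' V₀ := by simpa using hV₀
    have hwV₀ : 0 < w V₀ :=
      lt_of_le_of_ne (hw.1 V₀) (Ne.symm (hss.1 (show w' V₀ ≠ 0 from hV₀'.ne')))
    set t := w V₀ / w' V₀ with ht
    have ht0 : 0 < t := div_pos hwV₀ hV₀'
    have htw : ∀ V, 0 ≤ w V - t * w' V := by
      intro V
      rcases (hw'.1 V).eq_or_lt with h | h
      · rw [← h]
        simpa using hw.1 V
      · have := (le_div_iff₀ h).1 (hle V (by simpa using h))
        linarith
    have hsum : ∑ V, (w V - t * w' V) = 1 - t := by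
      rw [Finset.sum_sub_distrib, ← Finset.mul_sum, hw.2.1, hw'.2.1, mul_one]
    have ht1 : t < 1 := by
      by_contra! h
      have h0 : ∑ V, (w V - t * w' V) = 0 :=
        le_antisymm (by rw [hsum]; linarith) (Finset.sum_nonneg fun V _ => htw V)
      have h1 := (Finset.sum_eq_zero_iff_of_nonneg fun V _ => htw V).1 h0
      refine hss.2 fun V hV => ?_
      have h2 := h1 V (Finset.mem_univ V)
      intro h3
      rw [h3] at h2
      exact hV (by linarith)
    have ht1' : 0 < 1 - t := by linarith
    -- What remains of `w`, normalized, lacks the member `V₀`.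
    set w'' : PureDevice X A → ℝ := fun V => (w V - t * w' V) / (1 - t) with hw''
    have hens : IsPureEnsemble P w'' := by
      refine ⟨fun V => div_nonneg (htw V) ht1'.le, ?_, fun x a => ?_⟩
      · simp only [hw'']
        rw [← Finset.sum_div, hsum, div_self ht1'.ne']
      · have e : ∀ V, w'' V * V.1 x a = (w V * V.1 x a - t * (w' V * V.1 x a)) / (1 - t) := by
          intro V
          simp only [hw'']
          ring
        simp only [e]
        rw [← Finset.sum_div, Finset.sum_sub_distrib, ← Finset.mul_sum, hw.2.2, hw'.2.2]
        field_simp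
    have hss' : Function.support w'' ⊂ Function.support w := by
      refine ⟨fun V hV => ?_, fun h => ?_⟩
      · intro h0
        by_cases h1 : w' V = 0
        · exact hV (by simp [hw'', h0, h1])
        · exact hss.1 h1 h0
      · refine h hwV₀.ne' ?_
        simp only [hw'', ht]
        field_simp
        simp
    have hw''mem := ih _ (hn ▸ Set.ncard_lt_ncard hss' (Set.toFinite _)) w'' hens rfl
    have hcomb := convex_convexHull ℝ (Set.range fun z : MinimalEnsemble P => z.1) hw'mem hw''mem
      ht0.le ht1'.le (by ring)
    convert hcomb using 1
    funext V
    simp only [Pi.add_apply, Pi.smul_apply, smul_eq_mul, hw'']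
    field_simp
    ring

theorem nonempty_minimalEnsemble {P : Box X A} (hP : P ∈ nsPolytope X A) :
    Nonempty (MinimalEnsemble P) := by
  obtain ⟨w, hw⟩ := exists_isPureEnsemble hP
  obtain ⟨l, -⟩ := hw.exists_mixture
  by_contra h
  rw [not_nonempty_iff] at h
  have := l.2.2
  simp at this

end Ensembles

section Copies

variable {X A : Party → Type*}

/-- Joint outputs of `N` pairs of parties, sorted by the pairs. -/
def outputsEquiv (A : Party → Type*) (N : ℕ) :
    (∀ j : Fin N × Party, A j.2) ≃ (Fin N → ∀ i, A i) where
  toFun a n i := a (n, i)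
  invFun b j := b j.1 j.2
  left_inv _ := rfl
  right_inv _ := rfl

/-- Independent devices `V n`, held by different pairs of parties. -/
def tensor {N : ℕ} (V : Fin N → Box X A) :
    Box (fun j : Fin N × Party => X j.2) (fun j : Fin N × Party => A j.2) :=
  fun x a => ∏ n, V n (fun i => x (n, i)) (fun i => a (n, i))

variable [∀ i, Fintype (A i)]

theorem tensor_mem_nsPolytope {N : ℕ} {V : Fin N → Box X A} (hV : ∀ n, V n ∈ nsPolytope X A) :
    tensor V ∈ nsPolytope (fun j : Fin N × Party => X j.2) (fun j : Fin N × Party => A j.2) := by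
  classical
  refine ⟨fun x a => Finset.prod_nonneg fun n _ => (hV n).1 _ _, fun x => ?_, ?_⟩
  · rw [← (outputsEquiv A N).symm.sum_comp]
    change ∑ b : Fin N → ∀ i, A i, ∏ n, V n (fun i => x (n, i)) (b n) = 1
    rw [sum_prod_fun fun n => V n fun i => x (n, i)]
    simp only [(hV _).2.1, Finset.prod_const_one]
  · intro S x x' hx a
    have e : ∀ y : ∀ j : Fin N × Party, X j.2,
        (∑ a', if ∀ j ∈ S, a' j = a j then tensor V y a' else 0) =
        ∏ n, ∑ b : ∀ i, A i, if ∀ i ∈ {i | (n, i) ∈ S}, b i = a (n, i) then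
          V n (fun i => y (n, i)) b else 0 := by
      intro y
      rw [← sum_prod_fun fun n b => if ∀ i ∈ {i | (n, i) ∈ S}, b i = a (n, i) then
          V n (fun i => y (n, i)) b else 0, ← (outputsEquiv A N).symm.sum_comp]
      refine Finset.sum_congr rfl fun b _ => ?_
      split_ifs with h
      · refine Finset.prod_congr rfl fun n _ => ?_
        exact (if_pos fun i hi => h (n, i) hi).symm
      · push Not at h
        obtain ⟨⟨n, i⟩, hj, hne⟩ := h
        refine (Finset.prod_eq_zero (Finset.mem_univ n) ?_).symm
        exact if_neg fun h => hne (h i hj)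
    rw [e, e]
    refine Finset.prod_congr rfl fun n _ => ?_
    exact (hV n).2.2 {i | (n, i) ∈ S} _ _ (fun i hi => hx (n, i) hi) fun i => a (n, i)

variable [∀ i, Fintype (X i)]

/-- The adversary can measure `N` copies independently: for every distribution `p` of her input in
the complete extension of `P` there is a distribution of her input in the complete extension of
`P^{⊗N}` and a post-processing of her output which together give `N` independent copies of the
tripartite distribution. Each tensor product of pure devices is split into pure devices, and the
post-processing recovers from which product a pure device came. -/
theorem exists_product_measurement {P : Box X A} (p : stdSimplex ℝ (MinimalEnsemble P))
    (N : ℕ) :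
    ∃ (ζ : stdSimplex ℝ (MinimalEnsemble (copies P N)))
      (post : PureDevice (fun j : Fin N × Party => X j.2) (fun j : Fin N × Party => A j.2) →
        stdSimplex ℝ (Fin N → PureDevice X A)),
      ∀ (x : ∀ i, X i) (a : Fin N → A .alice) (b : Fin N → A .bob) (e : Fin N → PureDevice X A),
        ∑ z, ζ.1 z * ∑ V, completeExtension (copies P N) z V (fun j => x j.2)
          (fun j => pair (a j.1) (b j.1) j.2) * (post V).1 e =
        ∏ n, measured (completeExtension P) x p (a n) (b n) (e n) := by
  classical
  -- The mixture `w` of the minimal ensembles with weights `p`.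
  set w : PureDevice X A → ℝ := fun V => ∑ z, p.1 z * z.1 V with hw
  have hw0 : ∀ V, 0 ≤ w V := fun V =>
    Finset.sum_nonneg fun z _ => mul_nonneg (p.2.1 z) (z.2.1.1 V)
  have hw1 : ∑ V, w V = 1 := by
    simp only [hw]
    rw [Finset.sum_comm]
    refine Eq.trans (Finset.sum_congr rfl fun z _ => ?_) p.2.2
    rw [← Finset.mul_sum, z.2.1.2.1, mul_one]
  have hwP : ∀ x a, ∑ V, w V * V.1 x a = P x a := by
    intro x a
    simp only [hw, Finset.sum_mul]
    rw [Finset.sum_comm, ← one_mul (P x a), ← p.2.2, Finset.sum_mul]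
    refine Finset.sum_congr rfl fun z _ => ?_
    simp only [mul_assoc, ← Finset.mul_sum]
    exact congrArg _ (z.2.1.2.2 x a)
  have hmeas : ∀ x a b e, measured (completeExtension P) x p a b e = w e * e.1 x (pair a b) := by
    intro x a b e
    simp only [measured, completeExtension, hw, Finset.sum_mul, mul_assoc]
  -- The tensor product of the pure devices `e n` is the average of pure devices with weights `l e`.
  choose l hl using fun e : Fin N → PureDevice X A =>
    exists_isPureEnsemble (tensor_mem_nsPolytope fun n => (e n).2.1)
  set we : (Fin N → PureDevice X A) → ℝ := fun e => ∏ n, w (e n) with hwe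
  have hwe0 : ∀ e, 0 ≤ we e := fun e => Finset.prod_nonneg fun n _ => hw0 _
  have hwe1 : ∑ e, we e = 1 := by
    rw [hwe, sum_prod_fun fun _ => w, hw1, Finset.prod_const_one]
  set W : PureDevice (fun j : Fin N × Party => X j.2) (fun j : Fin N × Party => A j.2) → ℝ :=
    fun V => ∑ e, we e * l e V with hW
  have hWens : IsPureEnsemble (copies P N) W := by
    refine ⟨fun V => Finset.sum_nonneg fun e _ => mul_nonneg (hwe0 e) ((hl e).1 V), ?_, ?_⟩
    · simp only [hW]
      rw [Finset.sum_comm]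
      simp only [← Finset.mul_sum, (hl _).2.1, mul_one, hwe1]
    · intro x a
      simp only [hW, Finset.sum_mul]
      rw [Finset.sum_comm]
      simp only [mul_assoc, ← Finset.mul_sum, (hl _).2.2]
      simp only [hwe, tensor, ← Finset.prod_mul_distrib]
      rw [sum_prod_fun fun n (V : PureDevice X A) =>
        w V * V.1 (fun i => x (n, i)) fun i => a (n, i)]
      simp only [hwP]
      rfl
  obtain ⟨ζ, hζ⟩ := hWens.exists_mixture
  -- The posterior probabilities of `e` given `V`, arbitrary where `W V = 0`.
  have hpost : ∀ V, ∃ r : stdSimplex ℝ (Fin N → PureDevice X A),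
      ∀ e, W V * r.1 e = we e * l e V := by
    intro V
    rcases eq_or_ne (W V) 0 with h | h
    · refine ⟨⟨we, hwe0, hwe1⟩, fun e => ?_⟩
      have := (Finset.sum_eq_zero_iff_of_nonneg fun e _ =>
        mul_nonneg (hwe0 e) ((hl e).1 V)).1 h e (Finset.mem_univ e)
      rw [h, this, zero_mul]
    · refine ⟨⟨fun e => we e * l e V / W V, fun e => div_nonneg (mul_nonneg (hwe0 e) ((hl e).1 V))
        (hWens.1 V), ?_⟩, fun e => ?_⟩
      · rw [← Finset.sum_div, div_self h]
      · exact mul_div_cancel₀ _ h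
  choose post hpost using hpost
  refine ⟨ζ, post, fun x a b e => ?_⟩
  have e1 : ∀ V, W V * (post V).1 e = we e * l e V := fun V => hpost V e
  calc _ = ∑ V, W V * (post V).1 e *
        V.1 (fun j => x j.2) (fun j => pair (a j.1) (b j.1) j.2) := by
        simp only [Finset.mul_sum]
        rw [Finset.sum_comm]
        refine Finset.sum_congr rfl fun V _ => ?_
        rw [← hζ, Finset.sum_mul, Finset.sum_mul]
        refine Finset.sum_congr rfl fun z _ => ?_
        rw [completeExtension]
        ring
    _ = we e * ∑ V, l e V * V.1 (fun j => x j.2) (fun j => pair (a j.1) (b j.1) j.2) := by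
        simp only [e1, Finset.mul_sum, mul_assoc]
    _ = _ := by
        rw [(hl e).2.2]
        simp only [hwe, tensor, hmeas, Finset.prod_mul_distrib]

end Copies

/-! ### The non-signaling norm -/

section Norm

variable {Z C E K : Type*} [Fintype Z] [Fintype C] [Fintype E] [Fintype K]

theorem DistinguishingOp.sum_abs_apply_sub_le (g : DistinguishingOp Z C E) (S S' : Z → C → E → ℝ) :
    ∑ k, |g.apply S k - g.apply S' k| ≤ ∑ c, ∑ z, ∑ e, |S z c e - S' z c e| := by
  have h1 : ∀ k, |g.apply S k - g.apply S' k| ≤ ∑ c, ∑ r, ∑ e,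
      (g.dice c).1 r * |S (g.wire c r) c e - S' (g.wire c r) c e| * (g.post c r e).1 k := by
    intro k
    simp only [DistinguishingOp.apply, ← Finset.sum_sub_distrib]
    refine (Finset.abs_sum_le_sum_abs _ _).trans (Finset.sum_le_sum fun c _ => ?_)
    refine (Finset.abs_sum_le_sum_abs _ _).trans (Finset.sum_le_sum fun r _ => ?_)
    refine (Finset.abs_sum_le_sum_abs _ _).trans (Finset.sum_le_sum fun e _ => ?_)
    rw [← sub_mul, ← mul_sub, abs_mul, abs_mul, abs_of_nonneg ((g.dice c).2.1 r),
      abs_of_nonneg ((g.post c r e).2.1 k)]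
  refine (Finset.sum_le_sum fun k _ => h1 k).trans ?_
  rw [Finset.sum_comm]
  refine Finset.sum_le_sum fun c _ => ?_
  rw [Finset.sum_comm]
  calc _ = ∑ r, (g.dice c).1 r * ∑ e, |S (g.wire c r) c e - S' (g.wire c r) c e| := by
        refine Finset.sum_congr rfl fun r _ => ?_
        rw [Finset.sum_comm, Finset.mul_sum]
        simp only [← Finset.mul_sum, (g.post _ _ _).2.2, mul_one]
    _ ≤ ∑ r, (g.dice c).1 r * ∑ z, ∑ e, |S z c e - S' z c e| := by
        refine Finset.sum_le_sum fun r _ => mul_le_mul_of_nonneg_left ?_ ((g.dice c).2.1 r)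
        exact Finset.single_le_sum (f := fun z => ∑ e, |S z c e - S' z c e|)
          (fun z _ => Finset.sum_nonneg fun e _ => abs_nonneg _) (Finset.mem_univ _)
    _ = _ := by rw [← Finset.sum_mul, (g.dice c).2.2, one_mul]

/-- The non-signaling norm dominates the distance after an input distribution `ζ` which does not
depend on the classical variable, and a post-processing of the output of the device. -/
theorem half_sum_abs_le_nsDist (S S' : Z → C → E → ℝ) (ζ : stdSimplex ℝ Z)
    (post : E → stdSimplex ℝ K) :
    1 / 2 * ∑ c, ∑ k, |(∑ z, ζ.1 z * ∑ e, S z c e * (post e).1 k) -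
      ∑ z, ζ.1 z * ∑ e, S' z c e * (post e).1 k| ≤ nsDist S S' := by
  classical
  have hb : BddAbove (Set.range fun g : DistinguishingOp Z C E =>
      1 / 2 * ∑ k, |g.apply S k - g.apply S' k|) := by
    refine ⟨1 / 2 * ∑ c, ∑ z, ∑ e, |S z c e - S' z c e|, ?_⟩
    rintro _ ⟨g, rfl⟩
    exact mul_le_mul_of_nonneg_left (g.sum_abs_apply_sub_le S S') (by norm_num)
  let eZ := (Fintype.equivFin Z).symm
  let eK := (Fintype.equivFin (C × K)).symm
  let g : DistinguishingOp Z C E :=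
    { diceCard := Fintype.card Z
      outcomes := Fintype.card (C × K)
      dice := fun _ => ⟨fun r => ζ.1 (eZ r), fun r => ζ.2.1 _, by
        rw [eZ.sum_comp ζ.1, ζ.2.2]⟩
      wire := fun _ r => eZ r
      post := fun c _ e => ⟨fun k => if (eK k).1 = c then (post e).1 (eK k).2 else 0,
        fun k => by
          change (0 : ℝ) ≤ if (eK k).1 = c then (post e).1 (eK k).2 else 0
          split_ifs
          · exact (post e).2.1 _
          · exact le_rfl, by
        rw [eK.sum_comp fun i => if i.1 = c then (post e).1 i.2 else 0, Fintype.sum_prod_type]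
        simp [Finset.sum_ite_irrel, (post e).2.2]⟩ }
  have happ : ∀ (T : Z → C → E → ℝ) k, g.apply T k =
      ∑ z, ζ.1 z * ∑ e, T z (eK k).1 e * (post e).1 (eK k).2 := by
    intro T k
    simp only [DistinguishingOp.apply, g, mul_ite, mul_zero]
    rw [Finset.sum_eq_single (eK k).1]
    · simp only [if_true]
      rw [eZ.sum_comp fun z => ∑ e, ζ.1 z * T z (eK k).1 e * (post e).1 (eK k).2]
      simp only [Finset.mul_sum, mul_assoc]
    · intro c _ hc
      simp [hc.symm]
    · simp
  refine le_trans (le_of_eq ?_) (le_ciSup hb g)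
  simp only [happ]
  rw [← Fintype.sum_prod_type', ← eK.sum_comp]

end Norm

/-! ### Comparison of the information quantities -/

section Comparison

variable {α β γ : Type*} [Fintype α] [Fintype β] [Fintype γ]

/-- The channel which forgets its input. -/
def trivialChannel (γ : Type*) : Channel γ :=
  ⟨1, fun _ => ⟨fun _ => 1, fun _ => zero_le_one, by simp⟩⟩

instance nonemptyChannel : Nonempty (Channel γ) := ⟨trivialChannel γ⟩

theorem condMutualInfo_comp_equiv {δ : Type*} [Fintype δ] (e : δ ≃ γ) (p : α → β → γ → ℝ) :
    condMutualInfo (fun a b c => p a b (e c)) = condMutualInfo p := by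
  rw [condMutualInfo_eq_sum, condMutualInfo_eq_sum]
  refine Finset.sum_congr rfl fun a _ => Finset.sum_congr rfl fun b _ => ?_
  exact e.sum_comp fun c => p a b c *
      (Real.logb 2 (p a b c) - Real.logb 2 (∑ b', p a b' c) - Real.logb 2 (∑ a', p a' b c) +
        Real.logb 2 (∑ a', ∑ b', p a' b' c))

variable {p : α → β → γ → ℝ}

theorem channel_condMutualInfo_nonneg (hp : ∀ a b e, 0 ≤ p a b e) (Θ : Channel γ) :
    0 ≤ condMutualInfo fun a b (e' : Fin Θ.1) => ∑ e, (Θ.2 e).1 e' * p a b e :=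
  condMutualInfo_nonneg fun _ _ _ => Finset.sum_nonneg fun e _ =>
    mul_nonneg ((Θ.2 e).2.1 _) (hp _ _ _)

theorem intrinsicInfo_nonneg (hp : ∀ a b e, 0 ≤ p a b e) : 0 ≤ intrinsicInfo p :=
  Real.iInf_nonneg (channel_condMutualInfo_nonneg hp)

theorem intrinsicInfo_le (hp : ∀ a b e, 0 ≤ p a b e) (Θ : Channel γ) :
    intrinsicInfo p ≤ condMutualInfo fun a b (e' : Fin Θ.1) => ∑ e, (Θ.2 e).1 e' * p a b e :=
  ciInf_le ⟨0, by rintro _ ⟨Θ, rfl⟩; exact channel_condMutualInfo_nonneg hp Θ⟩ Θ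

theorem intrinsicInfo_le_condMutualInfo (hp : ∀ a b e, 0 ≤ p a b e) :
    intrinsicInfo p ≤ condMutualInfo p := by
  classical
  let e := Fintype.equivFin γ
  refine (intrinsicInfo_le hp ⟨Fintype.card γ, fun c =>
    ⟨Pi.single (e c) 1, single_mem_stdSimplex ℝ (e c)⟩⟩).trans_eq ?_
  rw [← condMutualInfo_comp_equiv e.symm]
  congr 1
  funext a b k
  rw [Finset.sum_eq_single (e.symm k)]
  · simp
  · intro c _ hc
    have : k ≠ e c := fun h => hc (by simp [h])
    simp [this]
  · simp

/-- The channel which forgets `E` turns the conditional mutual information into the unconditional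
one. -/
theorem intrinsicInfo_le_mutualInfo (hp : ∀ a b e, 0 ≤ p a b e)
    (hp1 : ∑ a, ∑ b, ∑ e, p a b e = 1) : intrinsicInfo p ≤ mutualInfo p := by
  refine (intrinsicInfo_le hp (trivialChannel γ)).trans_eq ?_
  change condMutualInfo (fun a b (_ : Fin 1) => ∑ e, 1 * p a b e) = _
  have h2 : ∑ b, ∑ a, ∑ e, p a b e = 1 := by rw [Finset.sum_comm, hp1]
  simp [condMutualInfo, condEntropy, mutualInfo, entropy, Fintype.sum_prod_type, hp1, h2]

theorem sum_channel_apply (hp1 : ∑ a, ∑ b, ∑ e, p a b e = 1) (Θ : Channel (α × β × γ)) :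
    ∑ u, ∑ a, ∑ b, ∑ e, (Θ.2 (a, b, e)).1 u * p a b e = 1 := by
  rw [← hp1, Finset.sum_comm]
  refine Finset.sum_congr rfl fun a _ => ?_
  rw [Finset.sum_comm]
  refine Finset.sum_congr rfl fun b _ => ?_
  rw [Finset.sum_comm]
  refine Finset.sum_congr rfl fun e _ => ?_
  rw [← Finset.sum_mul, (Θ.2 _).2.2, one_mul]

theorem reducedIntrinsicInfo_terms_nonneg (hp : ∀ a b e, 0 ≤ p a b e)
    (hp1 : ∑ a, ∑ b, ∑ e, p a b e = 1) (Θ : Channel (α × β × γ)) :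
    0 ≤ intrinsicInfo (fun a b (eu : γ × Fin Θ.1) => (Θ.2 (a, b, eu.1)).1 eu.2 * p a b eu.1) +
      entropy fun u : Fin Θ.1 => ∑ a, ∑ b, ∑ e, (Θ.2 (a, b, e)).1 u * p a b e := by
  refine add_nonneg (intrinsicInfo_nonneg fun a b eu => mul_nonneg ((Θ.2 _).2.1 _) (hp _ _ _))
    (entropy_nonneg (fun u => Finset.sum_nonneg fun a _ => Finset.sum_nonneg fun b _ =>
      Finset.sum_nonneg fun e _ => mul_nonneg ((Θ.2 _).2.1 _) (hp _ _ _)) ?_)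
  exact sum_channel_apply hp1 Θ

theorem reducedIntrinsicInfo_nonneg (hp : ∀ a b e, 0 ≤ p a b e)
    (hp1 : ∑ a, ∑ b, ∑ e, p a b e = 1) : 0 ≤ reducedIntrinsicInfo p :=
  Real.iInf_nonneg (reducedIntrinsicInfo_terms_nonneg hp hp1)

theorem reducedIntrinsicInfo_le_intrinsicInfo (hp : ∀ a b e, 0 ≤ p a b e)
    (hp1 : ∑ a, ∑ b, ∑ e, p a b e = 1) : reducedIntrinsicInfo p ≤ intrinsicInfo p := by
  refine (ciInf_le ⟨0, by
    rintro _ ⟨Θ, rfl⟩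
    exact reducedIntrinsicInfo_terms_nonneg hp hp1 Θ⟩ (trivialChannel (α × β × γ))).trans ?_
  have h0 : (entropy fun u : Fin (trivialChannel (α × β × γ)).1 =>
      ∑ a, ∑ b, ∑ e, ((trivialChannel (α × β × γ)).2 (a, b, e)).1 u * p a b e) = 0 := by
    simp [entropy, trivialChannel, hp1]
  rw [h0, add_zero]
  refine le_ciInf fun Θ => ?_
  refine (intrinsicInfo_le (fun a b eu => mul_nonneg (((trivialChannel (α × β × γ)).2 _).2.1 _)
    (hp _ _ _)) ⟨Θ.1, fun eu => Θ.2 eu.1⟩).trans_eq ?_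
  change condMutualInfo (fun a b e' => ∑ eu : γ × Fin 1, (Θ.2 eu.1).1 e' * (1 * p a b eu.1)) = _
  simp [Fintype.sum_prod_type]

end Comparison

section Squash

variable {X A : Party → Type*} [∀ i, Fintype (X i)] [∀ i, Fintype (A i)]

/-- A pair of values as a function on the two parties. -/
def pairEquiv (A : Party → Type*) : A .alice × A .bob ≃ ∀ i, A i where
  toFun t := pair t.1 t.2
  invFun a := (a .alice, a .bob)
  left_inv _ := rfl
  right_inv a := by
    funext i
    cases i <;> rfl

theorem measured_nonneg {P : Box X A} (x : ∀ i, X i) (p : stdSimplex ℝ (MinimalEnsemble P))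
    (a : A .alice) (b : A .bob) (e : PureDevice X A) :
    0 ≤ measured (completeExtension P) x p a b e :=
  Finset.sum_nonneg fun z _ => mul_nonneg (p.2.1 z) (mul_nonneg (z.2.1.1 e) (e.2.1.1 _ _))

theorem sum_measured {P : Box X A} (x : ∀ i, X i) (p : stdSimplex ℝ (MinimalEnsemble P)) :
    ∑ a, ∑ b, ∑ e, measured (completeExtension P) x p a b e = 1 := by
  have h : ∀ V : PureDevice X A, ∑ t : A .alice × A .bob, V.1 x (pair t.1 t.2) = 1 := fun V => by
    rw [← V.2.1.2.1 x, ← (pairEquiv A).sum_comp]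
    rfl
  rw [← Fintype.sum_prod_type' (f := fun a b => ∑ e, measured (completeExtension P) x p a b e)]
  simp only [measured, completeExtension]
  rw [Finset.sum_comm]
  calc _ = ∑ e : PureDevice X A, ∑ z, ∑ t : A .alice × A .bob,
        p.1 z * (z.1 e * e.1 x (pair t.1 t.2)) := Finset.sum_congr rfl fun e _ => Finset.sum_comm
    _ = ∑ z, ∑ e : PureDevice X A, ∑ t : A .alice × A .bob,
        p.1 z * (z.1 e * e.1 x (pair t.1 t.2)) := Finset.sum_comm
    _ = 1 := by simp only [← Finset.mul_sum, h, mul_one, fun z : MinimalEnsemble P => z.2.1.2.1,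
        p.2.2]

theorem squash_le_squash (P : Box X A)
    {M M' : (A .alice → A .bob → PureDevice X A → ℝ) → ℝ}
    (h0 : ∀ m, (∀ a b e, 0 ≤ m a b e) → ∑ a, ∑ b, ∑ e, m a b e = 1 → 0 ≤ M m)
    (h : ∀ m, (∀ a b e, 0 ≤ m a b e) → ∑ a, ∑ b, ∑ e, m a b e = 1 → M m ≤ M' m) :
    squash M (completeExtension P) ≤ squash M' (completeExtension P) := by
  refine ciSup_mono (Set.finite_range _).bddAbove fun x => ?_
  refine ciInf_mono ⟨0, ?_⟩ fun p => h _ (measured_nonneg x p) (sum_measured x p)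
  rintro _ ⟨p, rfl⟩
  exact h0 _ (measured_nonneg x p) (sum_measured x p)

end Squash

/-! ### The bound on the key rate -/

section KeyRate

theorem sum_sum_comm {α β γ δ : Type*} [Fintype α] [Fintype β] [Fintype γ] [Fintype δ]
    (F : α → β → γ → δ → ℝ) :
    ∑ a, ∑ b, ∑ c, ∑ d, F a b c d = ∑ c, ∑ d, ∑ a, ∑ b, F a b c d := by
  have h := Finset.sum_comm (s := Finset.univ) (t := Finset.univ)
    (f := fun (i : α × β) (j : γ × δ) => F i.1 i.2 j.1 j.2)
  simpa only [Fintype.sum_prod_type] using h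

variable {X A : Party → Type*} [∀ i, Fintype (X i)] [∀ i, Fintype (A i)]

/-- The bound on the length of the key distilled from `N` copies. The adversary measures all copies
independently, with input distribution `p` for each of them. -/
theorem MDLOPC.logb_keyCard_le [∀ i, Nonempty (A i)] {N : ℕ} (Λ : MDLOPC X A N) {P : Box X A}
    (p : stdSimplex ℝ (MinimalEnsemble P)) (Θ : Channel (A .alice × A .bob × PureDevice X A))
    (Φ : Channel (PureDevice X A × Fin Θ.1)) :
    Real.logb 2 Λ.lopc.keyCard ≤
      N * ((condMutualInfo fun a b (c : Fin Φ.1) => ∑ eu, (Φ.2 eu).1 c *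
          ((Θ.2 (a, b, eu.1)).1 eu.2 * measured (completeExtension P) Λ.x p a b eu.1)) +
        entropy fun u : Fin Θ.1 => ∑ a, ∑ b, ∑ e,
          (Θ.2 (a, b, e)).1 u * measured (completeExtension P) Λ.x p a b e) +
      (1 + 2 * nsDist (Λ.realState P) (Λ.idealState P) +
        2 * nsDist (Λ.realState P) (Λ.idealState P) * Real.logb 2 Λ.lopc.keyCard) := by
  classical
  set ε := nsDist (Λ.realState P) (Λ.idealState P) with hε
  set m := measured (completeExtension P) Λ.x p with hm
  have hm0 : ∀ a b e, 0 ≤ m a b e := measured_nonneg Λ.x p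
  have hm1 : ∑ a, ∑ b, ∑ e, m a b e = 1 := sum_measured Λ.x p
  have hpos := Λ.lopc.keyCard_pos
  have hne : Nonempty (Fin Λ.lopc.keyCard) := ⟨⟨0, hpos⟩⟩
  obtain ⟨ζ, post, hζ⟩ := exists_product_measurement p N
  set R : Fin Λ.lopc.keyCard → Fin Λ.lopc.keyCard → Λ.lopc.Transcript →
      (Fin N → PureDevice X A) → ℝ := fun s t q e =>
    ∑ a : Fin N → A .alice, ∑ b : Fin N → A .bob,
      Λ.lopc.outProb a b s t q * ∏ n, m (a n) (b n) (e n) with hR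
  set I : Fin Λ.lopc.keyCard → Fin Λ.lopc.keyCard → Λ.lopc.Transcript →
      (Fin N → PureDevice X A) → ℝ := fun s t q e =>
    (if s = t then 1 / (Λ.lopc.keyCard : ℝ) else 0) * ∑ s', ∑ t', R s' t' q e with hI
  -- `R` and `I` are the real and the ideal distribution under the product attack.
  have hreal : ∀ c e, ∑ z, ζ.1 z * ∑ V, Λ.realState P z c V * (post V).1 e =
      R c.1 c.2.1 c.2.2 e := by
    intro c e
    simp only [hR, hm]
    simp only [← hζ Λ.x, MDLOPC.realState, Finset.sum_mul, Finset.mul_sum]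
    rw [sum_sum_comm]
    refine Finset.sum_congr rfl fun a _ => Finset.sum_congr rfl fun b _ =>
      Finset.sum_congr rfl fun z _ => Finset.sum_congr rfl fun V _ => ?_
    ring
  have hideal : ∀ c e, ∑ z, ζ.1 z * ∑ V, Λ.idealState P z c V * (post V).1 e =
      I c.1 c.2.1 c.2.2 e := by
    intro c e
    have h1 : ∑ s', ∑ t', R s' t' c.2.2 e = ∑ z, ∑ V, ∑ s', ∑ t',
        ζ.1 z * (Λ.realState P z (s', t', c.2.2) V * (post V).1 e) := by
      refine Eq.trans ?_ (sum_sum_comm _)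
      refine Finset.sum_congr rfl fun s _ => Finset.sum_congr rfl fun t _ => ?_
      rw [← hreal (s, t, c.2.2) e]
      simp only [Finset.mul_sum]
    simp only [hI]
    rw [h1]
    simp only [MDLOPC.idealState, ← Finset.mul_sum, ← Finset.sum_mul]
    rw [Finset.mul_sum]
    refine Finset.sum_congr rfl fun z _ => ?_
    rw [mul_left_comm]
    congr 1
    rw [Finset.mul_sum]
    exact Finset.sum_congr rfl fun V _ => mul_assoc _ _ _
  have hdist := half_sum_abs_le_nsDist (Λ.realState P) (Λ.idealState P) ζ post
  simp only [hreal, hideal, ← hε, Fintype.sum_prod_type] at hdist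
  -- Real and ideal states have the same total mass, so positive and negative parts agree.
  have htot : ∑ s, ∑ t, ∑ q, ∑ e, (R s t q e - I s t q e) = 0 := by
    have h1 : ∑ s, ∑ t, ∑ q, ∑ e, I s t q e = ∑ s, ∑ t, ∑ q, ∑ e, R s t q e := by
      rw [sum_sum_comm R]
      simp only [hI, ← Finset.mul_sum, ← Finset.sum_mul, Finset.sum_ite_eq, Finset.mem_univ,
        if_true]
      simp [hpos.ne']
    simp only [Finset.sum_sub_distrib]
    rw [h1, sub_self]
  have hpart : ∑ s, ∑ t, ∑ q, ∑ e, max (R s t q e - I s t q e) 0 ≤ ε := by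
    have e1 : ∀ y : ℝ, max y 0 = 1 / 2 * |y| + 1 / 2 * y := by
      intro y
      rcases le_total y 0 with h | h
      · rw [max_eq_right h, abs_of_nonpos h]
        ring
      · rw [max_eq_left h, abs_of_nonneg h]
        ring
    simp only [e1, Finset.sum_add_distrib, ← Finset.mul_sum, htot]
    linarith
  have hΘ : ∀ (a : Fin N → A .alice) (b : Fin N → A .bob) (e : Fin N → PureDevice X A),
      ∑ u : Fin N → Fin Θ.1, ∏ n, (Θ.2 (a n, b n, e n)).1 (u n) = 1 := by
    intro a b e
    rw [sum_prod_fun fun n u => (Θ.2 (a n, b n, e n)).1 u]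
    simp only [(Θ.2 _).2.2, Finset.prod_const_one]
  have hΦ : ∀ x : (Fin N → PureDevice X A) × (Fin N → Fin Θ.1),
      ∑ c : Fin N → Fin Φ.1, ∏ n, (Φ.2 (x.1 n, x.2 n)).1 (c n) = 1 := by
    intro x
    rw [sum_prod_fun fun n c => (Φ.2 (x.1 n, x.2 n)).1 c]
    simp only [(Φ.2 _).2.2, Finset.prod_const_one]
  have key := logb_card_key_le (σ := Fin Λ.lopc.keyCard) (κ := Λ.lopc.Transcript)
    (p := fun (a : Fin N → A .alice) (b : Fin N → A .bob) (e : Fin N → PureDevice X A) =>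
      ∏ n, m (a n) (b n) (e n))
    (fun a b e => Finset.prod_nonneg fun n _ => hm0 _ _ _)
    (by rw [sum_prod_fun_fun_fun fun _ => m, hm1, Finset.prod_const_one])
    (θ := fun a b e (u : Fin N → Fin Θ.1) => ∏ n, (Θ.2 (a n, b n, e n)).1 (u n))
    (fun a b e u => Finset.prod_nonneg fun n _ => (Θ.2 _).2.1 _) hΘ
    (Φ := fun x (c : Fin N → Fin Φ.1) => ∏ n, (Φ.2 (x.1 n, x.2 n)).1 (c n))
    (fun x c => Finset.prod_nonneg fun n _ => (Φ.2 _).2.1 _) hΦ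
    (f := fun a q s => Λ.lopc.factorA a q * (Λ.lopc.keyA a q).1 s)
    (g := fun b q t => Λ.lopc.factorB b q * (Λ.lopc.keyB b q).1 t)
    (fun a q s => mul_nonneg (Λ.lopc.factorA_nonneg a q) ((Λ.lopc.keyA a q).2.1 s))
    (fun b q t => mul_nonneg (Λ.lopc.factorB_nonneg b q) ((Λ.lopc.keyB b q).2.1 t))
    (fun a b => Λ.lopc.sum_outProb a b) (R := R)
    (fun s t q e => by simp only [hR, Λ.lopc.outProb_eq]) (ε := ε)
    (by simpa only [Fintype.card_fin] using hpart)
  rw [Fintype.card_fin] at key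
  have e1 : (condMutualInfo fun (a : Fin N → A .alice) (b : Fin N → A .bob)
      (c : Fin N → Fin Φ.1) => ∑ x : (Fin N → PureDevice X A) × (Fin N → Fin Θ.1),
        (∏ n, (Φ.2 (x.1 n, x.2 n)).1 (c n)) * ((∏ n, (Θ.2 (a n, b n, x.1 n)).1 (x.2 n)) *
          ∏ n, m (a n) (b n) (x.1 n))) =
      N * condMutualInfo fun a b (c : Fin Φ.1) => ∑ eu, (Φ.2 eu).1 c *
          ((Θ.2 (a, b, eu.1)).1 eu.2 * m a b eu.1) := by
    rw [← condMutualInfo_pow]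
    · congr 1
      funext a b c
      rw [← sum_prod_fun fun n (eu : PureDevice X A × Fin Θ.1) => (Φ.2 eu).1 (c n) *
          ((Θ.2 (a n, b n, eu.1)).1 eu.2 * m (a n) (b n) eu.1),
        ← (Equiv.arrowProdEquivProdArrow (Fin N) (fun _ => PureDevice X A)
          (fun _ => Fin Θ.1)).sum_comp]
      simp only [← Finset.prod_mul_distrib]
      rfl
    · rw [← hm1]
      refine Finset.sum_congr rfl fun a _ => Finset.sum_congr rfl fun b _ => ?_
      rw [Finset.sum_comm]
      simp only [← Finset.sum_mul, (Φ.2 _).2.2, one_mul, Fintype.sum_prod_type, (Θ.2 _).2.2]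
  have e2 : (entropy fun u : Fin N → Fin Θ.1 => ∑ a : Fin N → A .alice, ∑ b : Fin N → A .bob,
      ∑ e : Fin N → PureDevice X A, (∏ n, (Θ.2 (a n, b n, e n)).1 (u n)) *
        ∏ n, m (a n) (b n) (e n)) =
      N * entropy fun u : Fin Θ.1 => ∑ a, ∑ b, ∑ e, (Θ.2 (a, b, e)).1 u * m a b e := by
    rw [← entropy_pow (sum_channel_apply hm1 Θ)]
    congr 1
    funext u
    simp only [← Finset.prod_mul_distrib]
    rw [sum_prod_fun_fun_fun fun n a b e => (Θ.2 (a, b, e)).1 (u n) * m a b e]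
  rw [e1, e2] at key
  rw [mul_add]
  exact key

theorem nonempty_outputs {X : Party → Type*} [∀ i, Nonempty (X i)] {P : Box X A}
    (hP : P ∈ nsPolytope X A) (i : Party) : Nonempty (A i) := by
  have h1 := hP.2.1 (Classical.arbitrary _)
  obtain ⟨a, -⟩ := Finset.exists_ne_zero_of_sum_ne_zero (by rw [h1]; exact one_ne_zero)
  exact ⟨a i⟩

/-- The squashed reduced intrinsic information bounds the rate of every protocol. -/
theorem keyRate_le [∀ i, Nonempty (X i)] {P : Box X A} (hP : P ∈ nsPolytope X A)
    {Λ : ∀ N, MDLOPC X A N} (hΛ : IsKeyDistillation P Λ) :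
    keyRate Λ ≤ (squashedReducedIntrinsicInfo P : EReal) := by
  have hA : ∀ i, Nonempty (A i) := nonempty_outputs hP
  obtain ⟨z₀⟩ := nonempty_minimalEnsemble hP
  have : Nonempty (stdSimplex ℝ (MinimalEnsemble P)) := by
    classical
    exact ⟨⟨Pi.single z₀ 1, single_mem_stdSimplex ℝ z₀⟩⟩
  by_contra! hlt
  obtain ⟨y, hy1, hy2⟩ := EReal.lt_iff_exists_real_btwn.1 hlt
  have hy : squashedReducedIntrinsicInfo P < y := by exact_mod_cast hy1
  refine absurd hy2 (not_lt.2 ?_)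
  -- For every pair of inputs there is an attack of value below `y`.
  have hattack : ∀ x : ∀ i, X i, ∃ (p : stdSimplex ℝ (MinimalEnsemble P))
      (Θ : Channel (A .alice × A .bob × PureDevice X A))
      (Φ : Channel (PureDevice X A × Fin Θ.1)),
      (condMutualInfo fun a b (c : Fin Φ.1) => ∑ eu, (Φ.2 eu).1 c *
          ((Θ.2 (a, b, eu.1)).1 eu.2 * measured (completeExtension P) x p a b eu.1)) +
        (entropy fun u : Fin Θ.1 => ∑ a, ∑ b, ∑ e,
          (Θ.2 (a, b, e)).1 u * measured (completeExtension P) x p a b e) < y := by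
    intro x
    have h1 : (⨅ p : stdSimplex ℝ (MinimalEnsemble P),
        reducedIntrinsicInfo (measured (completeExtension P) x p)) < y :=
      (le_ciSup (f := fun x : ∀ i, X i => ⨅ p : stdSimplex ℝ (MinimalEnsemble P),
        reducedIntrinsicInfo (measured (completeExtension P) x p))
        (Set.finite_range _).bddAbove x).trans_lt hy
    obtain ⟨p, hp⟩ := exists_lt_of_ciInf_lt h1
    obtain ⟨Θ, hΘ⟩ := exists_lt_of_ciInf_lt hp
    obtain ⟨Φ, hΦ⟩ := exists_lt_of_ciInf_lt (lt_sub_iff_add_lt.2 hΘ)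
    exact ⟨p, Θ, Φ, lt_sub_iff_add_lt.1 hΦ⟩
  set ε : ℕ → ℝ := fun N => nsDist ((Λ N).realState P) ((Λ N).idealState P)
  have hε0 : Filter.Tendsto ε Filter.atTop (nhds 0) := hΛ
  have hN : ∀ N, Real.logb 2 (Λ N).lopc.keyCard ≤
      N * y + (1 + 2 * ε N + 2 * ε N * Real.logb 2 (Λ N).lopc.keyCard) := by
    intro N
    obtain ⟨p, Θ, Φ, h⟩ := hattack (Λ N).x
    refine ((Λ N).logb_keyCard_le p Θ Φ).trans ?_
    gcongr
  have hinv : Filter.Tendsto (fun N : ℕ => ((N : ℝ))⁻¹) Filter.atTop (nhds 0) :=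
    tendsto_inv_atTop_nhds_zero_nat
  have hlim : Filter.Tendsto (fun N : ℕ => (y + (1 + 2 * ε N) * (N : ℝ)⁻¹) / (1 - 2 * ε N))
      Filter.atTop (nhds y) := by
    have h1 : Filter.Tendsto (fun N : ℕ => (y + (1 + 2 * ε N) * (N : ℝ)⁻¹) / (1 - 2 * ε N))
        Filter.atTop (nhds ((y + (1 + 2 * 0) * 0) / (1 - 2 * 0))) :=
      (tendsto_const_nhds.add ((tendsto_const_nhds.add (hε0.const_mul 2)).mul hinv)).div
        (tendsto_const_nhds.sub (hε0.const_mul 2)) (by norm_num)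
    simpa using h1
  have hle : ∀ᶠ N : ℕ in Filter.atTop, ((Real.logb 2 (Λ N).lopc.keyCard / N : ℝ) : EReal) ≤
      (((y + (1 + 2 * ε N) * (N : ℝ)⁻¹) / (1 - 2 * ε N) : ℝ) : EReal) := by
    filter_upwards [hε0.eventually (gt_mem_nhds (show (0 : ℝ) < 1 / 4 by norm_num)),
      Filter.eventually_gt_atTop 0] with N h1 h2
    have hNpos : (0 : ℝ) < N := by exact_mod_cast h2
    rw [EReal.coe_le_coe_iff, div_le_div_iff₀ hNpos (by linarith)]
    have h3 := hN N
    have h4 : (y + (1 + 2 * ε N) * (N : ℝ)⁻¹) * N = N * y + (1 + 2 * ε N) := by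
      field_simp
    rw [h4]
    linarith
  calc keyRate Λ ≤ Filter.limsup (fun N : ℕ =>
        (((y + (1 + 2 * ε N) * (N : ℝ)⁻¹) / (1 - 2 * ε N) : ℝ) : EReal)) Filter.atTop :=
        Filter.limsup_le_limsup hle
    _ = (y : EReal) := ((continuous_coe_real_ereal.tendsto y).comp hlim).limsup_eq

end KeyRate

end NSDI

theorem mainTheorem6 {X A : Party → Type*} [∀ i, Fintype (X i)] [∀ i, Nonempty (X i)]
    [∀ i, Fintype (A i)] (P : Box X A) (hP : P ∈ nsPolytope X A) :
    deviceIndependentKeyRate P ≤ (squashedMutualInfo P : EReal) ∧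
    deviceIndependentKeyRate P ≤ (squashedCondMutualInfo P : EReal) ∧
    deviceIndependentKeyRate P ≤
      ((min (squashedMutualInfo P) (squashedCondMutualInfo P) : ℝ) : EReal) ∧
    squashedReducedIntrinsicInfo P ≤ squashedNonlocality P ∧
    deviceIndependentKeyRate P ≤ (squashedReducedIntrinsicInfo P : EReal) := by
  have hK : deviceIndependentKeyRate P ≤ (squashedReducedIntrinsicInfo P : EReal) :=
    iSup₂_le fun Λ hΛ => keyRate_le hP hΛ
  have h1 : squashedReducedIntrinsicInfo P ≤ squashedMutualInfo P :=
    squash_le_squash P (fun _ => reducedIntrinsicInfo_nonneg) fun _ h h' =>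
      (reducedIntrinsicInfo_le_intrinsicInfo h h').trans (intrinsicInfo_le_mutualInfo h h')
  have h2 : squashedReducedIntrinsicInfo P ≤ squashedCondMutualInfo P :=
    squash_le_squash P (fun _ => reducedIntrinsicInfo_nonneg) fun _ h h' =>
      (reducedIntrinsicInfo_le_intrinsicInfo h h').trans (intrinsicInfo_le_condMutualInfo h)
  exact ⟨hK.trans (EReal.coe_le_coe_iff.2 h1), hK.trans (EReal.coe_le_coe_iff.2 h2),
    hK.trans (EReal.coe_le_coe_iff.2 (le_min h1 h2)),
    squash_le_squash P (fun _ => reducedIntrinsicInfo_nonneg) fun _ =>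
      reducedIntrinsicInfo_le_intrinsicInfo, hK⟩
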